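/- Let $\Phi$ be a classical root system of rank $r$, of type $A_r$, $B_r$, $C_r$ or $D_r$ (with $r\ge 2$ in type $D_r$), realized in $\mathbb R^n$, where $n=r+1$ in type $A_r$ and $n=r$ otherwise, with simple roots $\alpha_i=e_i-e_{i+1}$ for $i<r$, and $\alpha_r=e_r-e_{r+1}$, $e_r$, $2e_r$, $e_{r-1}+e_r$ in types $A_r,B_r,C_r,D_r$ respectively. A vector $v\in\mathbb R^n$ is a dominant (integral) weight if $2\langle v,\alpha_i\rangle/\langle\alpha_i,\alpha_i\rangle\in\mathbb Z_{\ge 0}$ for all $i$. A pair $(\lambda,\mu)$ of dominant weights is primitive if $\lambda-\mu=\sum_{i=1}^r c_i\alpha_i$ with $c_i\in\mathbb Z_{>0}$ for all $i$. In types $B_r$ and $C_r$, a pattern is an array of real numbers $\lambda_{i,j},\eta_{i,j}$ ($1\le i\le j\le r$) with $$\min(\lambda_{i,j},\lambda_{i+1,j})\ \ge\ \eta_{i,j}\ \ge\ \max(\lambda_{i,j+1},\lambda_{i+1,j+1}),$$ where entries outside the array are omitted, and $\eta_{i,r}\ge 0$ for all $i$. In type $D_r$, a pattern is an array of real numbers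 $\lambda_{i,j}$ ($1\le i\le j\le r$), $\eta_{i,j}$ ($1\le i\le j\le r-1$) with the same displayed inequalities and $$\lambda_{i,r}+\lambda_{i+1,r}+\min(\lambda_{i,r-1},\lambda_{i+1,r-1})\ \ge\ \eta_{i,r-1}\qquad(1\le i\le r-1),$$ where $\lambda_{r,r-1}=+\infty$. Its weight is the vector with coordinates $\mu_i=\sum_j\lambda_{i,j}+\sum_j\lambda_{i+1,j}-2\sum_j\eta_{i,j}$, $1\le i\le r$, empty sums being $0$. In type $A_r$, a pattern is a real Gelfand–Tsetlin pattern $\lambda_{i,j}$ ($1\le i\le j\le r+1$), $\lambda_{i,j}\ge\lambda_{i+1,j+1}\ge\lambda_{i,j+1}$, and its weight has coordinates $\mu_i=\sum_j\lambda_{i,j}-\sum_j\lambda_{i+1,j}$, $1\le i\le r+1$. For dominant weights $\lambda,\mu$ let $\mathrm{BZ}_\lambda$ be the polytope of all patterns with first row $(\lambda_{1,1},\dots,\lambda_{1,n})=\lambda$, and let $\mathrm{BZ}_{\lambda,\mu}$ be the set of all patterns in $\mathrm{BZ}_\lambda$ of weight $\mu$. If $(\lambda,\mu)$ is a primitive pair,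 then $\mathrm{BZ}_{\lambda,\mu}$ is nonempty and $$\dim\mathrm{BZ}_{\lambda,\mu}=\dim\mathrm{BZ}_\lambda-r,$$ where $\dim$ denotes the dimension of the affine span. -/

import Mathlib

/-- The four families of classical root systems. -/
inductive ClassicalType
  | A | B | C | D
  deriving DecidableEq

namespace ClassicalType

/-- The dimension `n` of the space `ℝⁿ` in which the rank `r` root system of the given type is
realized: type `A_r` lives in `ℝ^(r+1)`, types `B_r`, `C_r`, `D_r` live in `ℝ^r`. -/
def ambientDim : ClassicalType → ℕ → ℕ
  | A, r => r + 1
  | B, r => r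
  | C, r => r
  | D, r => r

/-- The number `m` such that the entries `η_{i,j}` of a pattern are indexed by `1 ≤ i ≤ j ≤ m`:
there are none in type `A`, and `m = r` in types `B`, `C` and `m = r - 1` in type `D`. -/
def etaSize : ClassicalType → ℕ → ℕ
  | A, _ => 0
  | B, r => r
  | C, r => r
  | D, r => r - 1

/-- Weights, written in the coordinates `e_1, …, e_n`. The index `k : Fin n` stands for
the coordinate of `e_{k+1}`. In type `A` a weight of `sl_{r+1}` is represented by any
vector in its class modulo `e_1 + ⋯ + e_{r+1}`. -/
abbrev Weight (X : ClassicalType) (r : ℕ) : Type := Fin (X.ambientDim r) → ℝ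

/-- The standard basis vector `e_k`, `1 ≤ k ≤ n`, of `ℝⁿ`. -/
def e (n k : ℕ) : Fin n → ℝ := fun j => if (j : ℕ) + 1 = k then 1 else 0

/-- The simple root `α_k`, `1 ≤ k ≤ r`: it is `e_k - e_{k+1}` for `k < r` (for all `k ≤ r` in
type `A`), and `α_r` is `e_r`, `2 e_r`, `e_{r-1} + e_r` in types `B`, `C`, `D`. -/
def simpleRootAt : (X : ClassicalType) → (r k : ℕ) → Weight X r
  | A, r, k => e (r + 1) k - e (r + 1) (k + 1)
  | B, r, k => if k < r then e r k - e r (k + 1) else e r r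
  | C, r, k => if k < r then e r k - e r (k + 1) else (2 : ℝ) • e r r
  | D, r, k => if k < r then e r k - e r (k + 1) else e r (r - 1) + e r r

/-- The family of simple roots; the index `i : Fin r` stands for `α_{i+1}`. -/
def simpleRoot (X : ClassicalType) (r : ℕ) (i : Fin r) : Weight X r :=
  simpleRootAt X r ((i : ℕ) + 1)

/-- The pairing `⟨v, α_i^∨⟩ = 2 ⟨v, α_i⟩ / ⟨α_i, α_i⟩` with a simple coroot. If
`v = ∑ i, d_i ω_i` in terms of fundamental weights, this is `d_i`. -/
noncomputable def corootPairing (X : ClassicalType) (r : ℕ) (v : Weight X r) (i : Fin r) : ℝ :=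
  2 * (v ⬝ᵥ simpleRoot X r i) / (simpleRoot X r i ⬝ᵥ simpleRoot X r i)

/-- Dominant integral weights: `v = ∑ i, d_i ω_i` with all `d_i` nonnegative integers. -/
def IsDominant (X : ClassicalType) (r : ℕ) (v : Weight X r) : Prop :=
  ∀ i : Fin r, ∃ d : ℕ, corootPairing X r v i = d

/-- A pair of dominant integral weights is primitive if `lam - mu = ∑ i, c_i α_i` with all
`c_i` positive integers. -/
def IsPrimitivePair (X : ClassicalType) (r : ℕ) (lam mu : Weight X r) : Prop :=
  IsDominant X r lam ∧ IsDominant X r mu ∧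
    ∃ c : Fin r → ℕ, (∀ i, 0 < c i) ∧ lam - mu = ∑ i, (c i : ℝ) • simpleRoot X r i

end ClassicalType

/-- The index set `{(i, j) : 1 ≤ i ≤ j ≤ m}` of a triangular array. -/
abbrev TriIndex (m : ℕ) : Type := {p : ℕ × ℕ // 1 ≤ p.1 ∧ p.1 ≤ p.2 ∧ p.2 ≤ m}

instance TriIndex.finite (m : ℕ) : Finite (TriIndex m) :=
  Set.Finite.to_subtype <| (Set.finite_Iic ((m, m) : ℕ × ℕ)).subset fun _ hp =>
    ⟨hp.2.1.trans hp.2.2, hp.2.2⟩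

/-- A triangular array of real numbers indexed by `1 ≤ i ≤ j ≤ m`. -/
abbrev TriArray (m : ℕ) : Type := TriIndex m → ℝ

/-- The entry of a triangular array in row `i` and column `j`. The value for indices outside
the triangle is `0`; it is never used in the inequalities below. -/
def TriArray.entry {m : ℕ} (f : TriArray m) (i j : ℕ) : ℝ :=
  if h : 1 ≤ i ∧ i ≤ j ∧ j ≤ m then f ⟨(i, j), h⟩ else 0

/-- The sum `∑_j f_{i,j}` of row `i`; it is `0` for `i > m`, where the row is empty. -/
def TriArray.rowSum {m : ℕ} (f : TriArray m) (i : ℕ) : ℝ :=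
  ∑ j ∈ Finset.Icc i m, f.entry i j

namespace ClassicalType

/-- The real vector space of arrays `(λ_{i,j}, η_{i,j})`, `λ_{i,j}` for `1 ≤ i ≤ j ≤ n` and
`η_{i,j}` for `1 ≤ i ≤ j ≤ m`, with `n = X.ambientDim r` and `m = X.etaSize r`. -/
abbrev PatternSpace (X : ClassicalType) (r : ℕ) : Type :=
  TriArray (X.ambientDim r) × TriArray (X.etaSize r)

/-- Interlacing in a Gelfand-Tsetlin pattern with rows `(λ_{i,i}, …, λ_{i,n})`:
`λ_{i,j} ≥ λ_{i+1,j+1} ≥ λ_{i,j+1}`. -/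
def GTInequalities {n : ℕ} (l : TriArray n) : Prop :=
  ∀ i j : ℕ, 1 ≤ i → i ≤ j → j + 1 ≤ n →
    l.entry (i + 1) (j + 1) ≤ l.entry i j ∧ l.entry i (j + 1) ≤ l.entry (i + 1) (j + 1)

/-- The inequalities
`min (λ_{i,j}, λ_{i+1,j}) ≥ η_{i,j} ≥ max (λ_{i,j+1}, λ_{i+1,j+1})`
for all entries `η_{i,j}`, where every comparison with an entry that is not in the array
(`λ_{i+1,j}` for `i = j`, `λ_{i,j+1}` and `λ_{i+1,j+1}` for `j = n`) is left out. -/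
def BZInequalities {n m : ℕ} (l : TriArray n) (η : TriArray m) : Prop :=
  ∀ i j : ℕ, 1 ≤ i → i ≤ j → j ≤ m →
    η.entry i j ≤ l.entry i j ∧
    (i + 1 ≤ j → η.entry i j ≤ l.entry (i + 1) j) ∧
    (j + 1 ≤ n → l.entry i (j + 1) ≤ η.entry i j ∧ l.entry (i + 1) (j + 1) ≤ η.entry i j)

/-- The additional inequalities `η_{i,r} ≥ 0` of types `B_r` and `C_r`. -/
def NonnegInequalities (r : ℕ) (η : TriArray r) : Prop :=
  ∀ i : ℕ, 1 ≤ i → i ≤ r → 0 ≤ η.entry i r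

/-- The additional inequalities
`λ_{i,r} + λ_{i+1,r} + min (λ_{i,r-1}, λ_{i+1,r-1}) ≥ η_{i,r-1}`
of type `D_r`, for `1 ≤ i ≤ r - 1`, where `λ_{r,r-1} = +∞`. -/
def TypeDInequalities (r : ℕ) (l : TriArray r) (η : TriArray (r - 1)) : Prop :=
  ∀ i : ℕ, 1 ≤ i → i ≤ r - 1 →
    η.entry i (r - 1) ≤ l.entry i r + l.entry (i + 1) r + l.entry i (r - 1) ∧
    (i + 1 ≤ r - 1 →
      η.entry i (r - 1) ≤ l.entry i r + l.entry (i + 1) r + l.entry (i + 1) (r - 1))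

/-- Real Berenstein-Zelevinsky patterns in types `B`, `C`, `D`, and real Gelfand-Tsetlin
patterns in type `A`. -/
def IsPattern : (X : ClassicalType) → (r : ℕ) → PatternSpace X r → Prop
  | A, r, T => GTInequalities (n := r + 1) T.1
  | B, r, T => BZInequalities (n := r) (m := r) T.1 T.2 ∧ NonnegInequalities r T.2
  | C, r, T => BZInequalities (n := r) (m := r) T.1 T.2 ∧ NonnegInequalities r T.2
  | D, r, T => BZInequalities (n := r) (m := r - 1) T.1 T.2 ∧ TypeDInequalities r T.1 T.2

/-- The weight of a pattern: `μ_i = |λ_i| + |λ_{i+1}| - 2 |η_i|` in types `B`, `C`, `D`, and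
`μ_i = |λ_i| - |λ_{i+1}|` in type `A`, where `|·|` denotes row sums. -/
def patternWeight : (X : ClassicalType) → (r : ℕ) → PatternSpace X r → Weight X r
  | A, r, T => fun k : Fin (r + 1) =>
      TriArray.rowSum (m := r + 1) T.1 ((k : ℕ) + 1)
        - TriArray.rowSum (m := r + 1) T.1 ((k : ℕ) + 2)
  | B, r, T => fun k : Fin r =>
      TriArray.rowSum (m := r) T.1 ((k : ℕ) + 1) + TriArray.rowSum (m := r) T.1 ((k : ℕ) + 2)
        - 2 * TriArray.rowSum (m := r) T.2 ((k : ℕ) + 1)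
  | C, r, T => fun k : Fin r =>
      TriArray.rowSum (m := r) T.1 ((k : ℕ) + 1) + TriArray.rowSum (m := r) T.1 ((k : ℕ) + 2)
        - 2 * TriArray.rowSum (m := r) T.2 ((k : ℕ) + 1)
  | D, r, T => fun k : Fin r =>
      TriArray.rowSum (m := r) T.1 ((k : ℕ) + 1) + TriArray.rowSum (m := r) T.1 ((k : ℕ) + 2)
        - 2 * TriArray.rowSum (m := r - 1) T.2 ((k : ℕ) + 1)

/-- The polytope `BZ_λ` of all real patterns of highest weight `λ`, that is, with first row
`λ_{1,j} = λ_j`. The first row is kept as a (constant) part of the array. -/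
def BZ (X : ClassicalType) (r : ℕ) (lam : Weight X r) : Set (PatternSpace X r) :=
  {T | IsPattern X r T ∧
    ∀ k : Fin (X.ambientDim r), T.1.entry 1 ((k : ℕ) + 1) = lam k}

/-- The polytope `BZ_{λ,μ}` of all real patterns of highest weight `λ` and weight `μ`. -/
def BZFiber (X : ClassicalType) (r : ℕ) (lam mu : Weight X r) : Set (PatternSpace X r) :=
  {T | T ∈ BZ X r lam ∧ patternWeight X r T = mu}

end ClassicalType

/-- The dimension of a nonempty convex set: the dimension of its affine span. -/
noncomputable def affineDim {V : Type*} [AddCommGroup V] [Module ℝ V] (S : Set V) : ℕ :=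
  Module.finrank ℝ (affineSpan ℝ S).direction

/-!
The weights of the patterns in `BZ X r lam` form a convex set `Q`, the image of a polytope under a
linear map. The fibre over a point in the relative interior of `Q` has dimension
`affineDim (BZ X r lam) - dim Q` (`Convex.affineDim_fiber`), so it suffices that `Q - mu` lies in
the span of the roots and is a neighbourhood of `0` there. By separation, the latter holds once
every functional `f` that is nonzero on the roots takes on `Q` a value greater than `⟨f, mu⟩`
(`exists_lt_weightMap`).

Let `g` be the dominant vector in the Weyl group orbit of `f`. Then `⟨f, mu⟩ ≤ ⟨g, mu⟩` because `mu`
is dominant: this is the rearrangement inequality for permutations, with a parity argument for the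
signs in type `D` (`dotProduct_le_scaleLastCoord`). Next, `⟨g, mu⟩ < ⟨g, lam⟩` because
`lam - mu` is a combination of all simple roots with positive coefficients, and `g` pairs
nonnegatively with all simple roots and positively with at least one. Finally, if `f = w g` in the
Weyl group, then `⟨g, lam⟩ = ⟨f, w lam⟩`, and `w lam` is the weight of a pattern.

The patterns of extremal weight `w lam` are built one row at a time (`exists_rows_A`,
`exists_rows_BC`, `exists_rows_D`): if the first coordinate of `w lam` is `± lam_k`, the next row is
`lam` with `lam_k` removed (in type `D` possibly with a sign change of its last entry), and the row
of `η` in between is chosen so that the weight comes out right. The rest is induction.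
-/

/-! ### Fibres of linear maps on convex sets -/

open Module

/-- A nonempty convex set in a finite-dimensional space has a point from which one can move a
little inside the set in every direction of its affine span. -/
theorem Convex.exists_forall_direction_exists_pos {V : Type*} [NormedAddCommGroup V]
    [NormedSpace ℝ V] [FiniteDimensional ℝ V] {S : Set V} (hS : Convex ℝ S) (hne : S.Nonempty) :
    ∃ p ∈ S, ∀ d ∈ (affineSpan ℝ S).direction, ∃ ε : ℝ, 0 < ε ∧ p + ε • d ∈ S := by
  obtain ⟨p, hp⟩ := hne.intrinsicInterior hS
  refine ⟨p, intrinsicInterior_subset hp, fun d hd => ?_⟩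
  obtain ⟨y, hy, rfl⟩ := mem_intrinsicInterior.1 hp
  let γ : ℝ → affineSpan ℝ S := fun t =>
    ⟨(t • d) +ᵥ (y : V), AffineSubspace.vadd_mem_of_mem_direction
      (Submodule.smul_mem _ t hd) y.2⟩
  have hγ : Continuous γ := by
    refine Continuous.subtype_mk ?_ _
    simp only [vadd_eq_add]
    fun_prop
  have h0 : γ 0 = y := by ext; simp [γ]
  have hnhds : γ ⁻¹' interior ((↑) ⁻¹' S) ∈ nhds (0 : ℝ) :=
    hγ.continuousAt.preimage_mem_nhds (isOpen_interior.mem_nhds (by rw [h0]; exact hy))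
  obtain ⟨δ, hδ, hball⟩ := Metric.mem_nhds_iff.1 hnhds
  refine ⟨δ / 2, by positivity, ?_⟩
  have hmem : δ / 2 ∈ Metric.ball (0 : ℝ) δ := by
    rw [Metric.mem_ball, Real.dist_eq, sub_zero, abs_of_pos (by positivity)]
    linarith
  have := interior_subset (hball hmem)
  simpa [γ, add_comm] using this

/-- Separation: a convex set on which every nonzero functional takes a positive value is a
neighbourhood of the origin. -/
theorem Convex.zero_mem_interior_of_forall_exists_pos {E : Type*} [NormedAddCommGroup E]
    [NormedSpace ℝ E] [FiniteDimensional ℝ E] {S : Set E} (hS : Convex ℝ S) (hne : S.Nonempty)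
    (h : ∀ φ : E →ₗ[ℝ] ℝ, φ ≠ 0 → ∃ s ∈ S, 0 < φ s) : (0 : E) ∈ interior S := by
  have hint : (interior S).Nonempty := by
    rw [hS.interior_nonempty_iff_affineSpan_eq_top]
    by_contra hspan
    have hdir : (affineSpan ℝ S).direction < ⊤ := by
      refine lt_top_iff_ne_top.2 fun htop => hspan ?_
      exact (AffineSubspace.direction_eq_top_iff_of_nonempty
        ((affineSpan_nonempty ℝ).2 hne)).1 htop
    obtain ⟨φ, hφ, hle⟩ := Submodule.exists_le_ker_of_lt_top _ hdir
    obtain ⟨s, hs, hs0⟩ := h φ hφ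
    obtain ⟨t, ht, ht0⟩ := h (-φ) (neg_ne_zero.2 hφ)
    have hst : s -ᵥ t ∈ (affineSpan ℝ S).direction :=
      AffineSubspace.vsub_mem_direction (subset_affineSpan ℝ S hs) (subset_affineSpan ℝ S ht)
    have := LinearMap.mem_ker.1 (hle hst)
    simp only [vsub_eq_sub, map_sub, LinearMap.neg_apply] at this ht0
    linarith
  by_contra h0
  obtain ⟨f, hf⟩ := geometric_hahn_banach_open_point hS.interior isOpen_interior h0
  rw [map_zero] at hf
  obtain ⟨a, ha⟩ := hint
  obtain ⟨s, hs, hs0⟩ := h (f : E →ₗ[ℝ] ℝ) (by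
    rintro h0
    have : f a = 0 := by
      rw [← ContinuousLinearMap.coe_coe, h0, LinearMap.zero_apply]
    linarith [hf a ha])
  have hcl : s ∈ closure (interior S) := by
    rw [hS.closure_interior_eq_closure_of_nonempty_interior ⟨a, ha⟩]
    exact subset_closure hs
  have hle : closure (interior S) ⊆ {x | f x ≤ 0} :=
    closure_minimal (fun x hx => (hf x hx).le) (isClosed_le f.continuous continuous_const)
  exact absurd hs0 (not_lt.2 (hle hcl))

/-- The dimension of a fibre of a linear map `w` on a convex set `P`. If `w P ⊆ μ + U` and `μ` is
not separated from `w P` by any functional that is nonzero on `U`, then `μ` is a relative interior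
point of `w P`, and the fibre over it has the expected dimension. -/
theorem Convex.affineDim_fiber {V E : Type*} [NormedAddCommGroup V] [NormedSpace ℝ V]
    [FiniteDimensional ℝ V] [NormedAddCommGroup E] [NormedSpace ℝ E] [FiniteDimensional ℝ E]
    {P : Set V} (hP : Convex ℝ P) (hne : P.Nonempty) (w : V →ₗ[ℝ] E) (μ : E) (U : Submodule ℝ E)
    (hU : ∀ T ∈ P, w T - μ ∈ U)
    (hsep : ∀ φ : E →ₗ[ℝ] ℝ, (∃ u ∈ U, φ u ≠ 0) → ∃ T ∈ P, φ μ < φ (w T)) :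
    {T | T ∈ P ∧ w T = μ}.Nonempty ∧
      affineDim {T | T ∈ P ∧ w T = μ} + finrank ℝ U = affineDim P := by
  set F : Set V := {T | T ∈ P ∧ w T = μ} with hF
  have hS : Convex ℝ {u : U | ∃ T ∈ P, w T = μ + u} := by
    rintro u ⟨T, hT, hTu⟩ v ⟨T', hT', hTv⟩ a b ha hb hab
    refine ⟨a • T + b • T', hP hT hT' ha hb hab, ?_⟩
    have hμ : μ = a • μ + b • μ := by rw [← add_smul, hab, one_smul]
    simp only [map_add, map_smul, hTu, hTv, Submodule.coe_add, Submodule.coe_smul, smul_add]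
    nth_rewrite 3 [hμ]
    abel
  have hcover : ∀ u ∈ U, ∃ ε : ℝ, 0 < ε ∧ ∃ T ∈ P, w T = μ + ε • u := by
    have h0 : (0 : U) ∈ interior {u : U | ∃ T ∈ P, w T = μ + u} := by
      refine hS.zero_mem_interior_of_forall_exists_pos ?_ fun φ hφ => ?_
      · obtain ⟨T, hT⟩ := hne
        exact ⟨⟨w T - μ, hU T hT⟩, T, hT, by simp⟩
      · obtain ⟨ψ, hψ⟩ := φ.exists_extend
        have hψu : ∀ u : U, ψ u = φ u := fun u => by rw [← hψ]; rfl
        obtain ⟨u, hu⟩ : ∃ u, φ u ≠ 0 := by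
          by_contra! hall
          exact hφ (LinearMap.ext hall)
        obtain ⟨T, hT, hlt⟩ := hsep ψ ⟨u, u.2, by rwa [hψu]⟩
        refine ⟨⟨w T - μ, hU T hT⟩, ⟨T, hT, by simp⟩, ?_⟩
        rw [← hψu, map_sub]
        linarith
    intro u hu
    have hγ : Continuous fun t : ℝ => t • (⟨u, hu⟩ : U) := by fun_prop
    have hnhds := hγ.continuousAt.preimage_mem_nhds (x := (0 : ℝ))
      (isOpen_interior.mem_nhds (by rw [zero_smul]; exact h0))
    obtain ⟨δ, hδ, hball⟩ := Metric.mem_nhds_iff.1 hnhds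
    have hmem : δ / 2 ∈ Metric.ball (0 : ℝ) δ := by
      rw [Metric.mem_ball, Real.dist_eq, sub_zero, abs_of_pos (by positivity)]
      linarith
    obtain ⟨T, hT, hw⟩ := interior_subset (hball hmem)
    exact ⟨δ / 2, by positivity, T, hT, hw⟩
  obtain ⟨p, hp, hmove⟩ := hP.exists_forall_direction_exists_pos hne
  -- The fibre meets the relative interior of `P`: continue from `w p` through `μ` to a point
  -- `w q` of the image, and take the point over `μ` on the segment from `p` to `q`.
  obtain ⟨ε, hε, q, hq, hwq⟩ := hcover (μ - w p)
    (by simpa using U.neg_mem (hU p hp))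
  set a : ℝ := ε / (1 + ε) with ha
  set b : ℝ := 1 / (1 + ε) with hb
  have ha0 : 0 < a := by positivity
  have hb0 : 0 < b := by positivity
  have hab : a + b = 1 := by rw [ha, hb]; field_simp; ring
  have habε : a = b * ε := by rw [ha, hb]; field_simp
  have hx : a • p + b • q ∈ F := by
    refine ⟨hP hp hq ha0.le hb0.le hab, ?_⟩
    have hb1 : b + b * ε = 1 := by rw [← habε, add_comm, hab]
    have : w (a • p + b • q) = (b + b * ε) • μ := by
      rw [map_add, map_smul, map_smul, hwq, habε]
      module
    rw [this, hb1, one_smul]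
  have hdir : (affineSpan ℝ F).direction =
      (affineSpan ℝ P).direction ⊓ LinearMap.ker w := by
    apply le_antisymm
    · refine le_inf (AffineSubspace.direction_le (affineSpan_mono ℝ fun T hT => hT.1)) ?_
      rw [direction_affineSpan, vectorSpan_def, Submodule.span_le]
      rintro _ ⟨T, hT, T', hT', rfl⟩
      simp [hT.2, hT'.2]
    · rintro d ⟨hd, hwd⟩
      obtain ⟨δ, hδ, hpd⟩ := hmove d hd
      have hxd : (a • p + b • q) + (a * δ) • d ∈ F := by
        refine ⟨?_, ?_⟩
        · have := hP hpd hq ha0.le hb0.le hab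
          convert this using 1
          module
        · rw [map_add, map_smul, LinearMap.mem_ker.1 hwd, smul_zero, add_zero, hx.2]
      have hmem := AffineSubspace.vsub_mem_direction (subset_affineSpan ℝ F hxd)
        (subset_affineSpan ℝ F hx)
      rw [vsub_eq_sub, add_sub_cancel_left] at hmem
      exact (Submodule.smul_mem_iff _ (by positivity)).1 hmem
  refine ⟨⟨_, hx⟩, ?_⟩
  have hmap : (affineSpan ℝ P).direction.map w = U := by
    apply le_antisymm
    · rw [Submodule.map_le_iff_le_comap, direction_affineSpan, vectorSpan_def, Submodule.span_le]
      rintro _ ⟨T, hT, T', hT', rfl⟩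
      have := U.sub_mem (hU T hT) (hU T' hT')
      simpa using this
    · intro u hu
      obtain ⟨δ, hδ, T, hT, hwT⟩ := hcover u hu
      have hmem := AffineSubspace.vsub_mem_direction (subset_affineSpan ℝ P hT)
        (subset_affineSpan ℝ P hx.1)
      refine ⟨δ⁻¹ • (T - (a • p + b • q)), Submodule.smul_mem _ _ hmem, ?_⟩
      rw [map_smul, map_sub, hwT, hx.2, add_sub_cancel_left, smul_smul,
        inv_mul_cancel₀ hδ.ne', one_smul]
  have hrn := (w.domRestrict (affineSpan ℝ P).direction).finrank_range_add_finrank_ker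
  rw [LinearMap.range_domRestrict, hmap, LinearMap.ker_domRestrict] at hrn
  have hk : finrank ℝ ((LinearMap.ker w).comap (affineSpan ℝ P).direction.subtype) =
      finrank ℝ (affineSpan ℝ F).direction := by
    rw [hdir, ← Submodule.finrank_map_subtype_eq, Submodule.map_comap_subtype]
  rw [affineDim, affineDim, ← hk, add_comm, hrn]

/-! ### Extremal patterns, row by row -/

/-- The sequence `x` with its entry of index `k` removed. -/
def removeEntry (k : ℕ) (x : ℕ → ℝ) : ℕ → ℝ := fun b => if b < k then x b else x (b + 1)

theorem sum_removeEntry (x : ℕ → ℝ) {k m : ℕ} (hk : k ≤ m) :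
    ∑ b ∈ Finset.range m, removeEntry k x b + x k = ∑ b ∈ Finset.range (m + 1), x b := by
  induction m, hk using Nat.le_induction with
  | base =>
    rw [Finset.sum_range_succ]
    congr 1
    exact Finset.sum_congr rfl fun b hb => if_pos (Finset.mem_range.1 hb)
  | succ m hm ih =>
    rw [Finset.sum_range_succ _ m, Finset.sum_range_succ _ (m + 1), ← ih]
    have : removeEntry k x m = x (m + 1) := if_neg (by omega)
    rw [this]
    ring

theorem removeEntry_anti {x : ℕ → ℝ} {m : ℕ} (hx : ∀ b, b + 1 < m + 1 → x (b + 1) ≤ x b) (k : ℕ) :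
    ∀ b, b + 1 < m → removeEntry k x (b + 1) ≤ removeEntry k x b := by
  intro b hb
  have h1 := hx b (by omega)
  have h2 := hx (b + 1) (by omega)
  unfold removeEntry
  split_ifs <;> linarith

/-- The index in `removeEntry k x` of the entry of `x` of index `s ≠ k`. -/
def removeIndex (k s : ℕ) : ℕ := if s < k then s else s - 1

theorem removeEntry_removeIndex (x : ℕ → ℝ) {k s : ℕ} (h : s ≠ k) :
    removeEntry k x (removeIndex k s) = x s := by
  unfold removeEntry removeIndex
  split_ifs <;> first | rfl | (congr 1; omega)

/-- An injection of `{0, …, m}` into itself, with the first value `σ 0` removed and the others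
renumbered. -/
theorem removeIndex_tail {σ : ℕ → ℕ} {m : ℕ} (hσ : ∀ a < m + 1, σ a < m + 1)
    (hinj : ∀ a < m + 1, ∀ a' < m + 1, σ a = σ a' → a = a') :
    (∀ a < m, σ (a + 1) ≠ σ 0) ∧ (∀ a < m, removeIndex (σ 0) (σ (a + 1)) < m) ∧
      ∀ a < m, ∀ a' < m, removeIndex (σ 0) (σ (a + 1)) = removeIndex (σ 0) (σ (a' + 1)) →
        a = a' := by
  have hne : ∀ a < m, σ (a + 1) ≠ σ 0 := fun a ha h => by
    have := hinj (a + 1) (by omega) 0 (by omega) h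
    omega
  have h0 := hσ 0 (by omega)
  refine ⟨hne, fun a ha => ?_, fun a ha a' ha' h => ?_⟩
  · have h1 := hne a ha
    have h2 := hσ (a + 1) (by omega)
    unfold removeIndex
    split_ifs <;> omega
  · have h1 := hne a ha
    have h2 := hne a' ha'
    have h3 : σ (a + 1) = σ (a' + 1) := by
      unfold removeIndex at h
      split_ifs at h <;> omega
    have := hinj _ (by omega) _ (by omega) h3
    omega

/-- Put a new first row on top of a family of rows. -/
def consRow (x : ℕ → ℝ) (l : ℕ → ℕ → ℝ) : ℕ → ℕ → ℝ
  | 0 => x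
  | a + 1 => l a

/-- Gelfand-Tsetlin patterns whose weight is a given permutation of the first row: each row arises
from the previous one by removing one entry. -/
theorem exists_rows_A (m : ℕ) : ∀ (x : ℕ → ℝ) (σ : ℕ → ℕ),
    (∀ b, b + 1 < m → x (b + 1) ≤ x b) → (∀ a < m, σ a < m) →
    (∀ a < m, ∀ a' < m, σ a = σ a' → a = a') →
    ∃ l : ℕ → ℕ → ℝ, l 0 = x ∧
      (∀ a b, a + b + 1 < m → l (a + 1) b ≤ l a b ∧ l a (b + 1) ≤ l (a + 1) b) ∧
      ∀ a < m, ∑ b ∈ Finset.range (m - a), l a b - ∑ b ∈ Finset.range (m - (a + 1)), l (a + 1) b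
        = x (σ a) := by
  induction m with
  | zero => exact fun x σ _ _ _ => ⟨fun _ => x, rfl, by omega, by omega⟩
  | succ m ih =>
    intro x σ hx hσ hinj
    obtain ⟨hne, hσ', hinj'⟩ := removeIndex_tail hσ hinj
    obtain ⟨l, hl0, hl, hw⟩ := ih (removeEntry (σ 0) x) (fun a => removeIndex (σ 0) (σ (a + 1)))
      (removeEntry_anti hx _) hσ' hinj'
    refine ⟨consRow x l, rfl, fun a b hab => ?_, fun a ha => ?_⟩
    · cases a with
      | zero =>
        simp only [consRow, hl0, removeEntry]
        have := hx b (by omega)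
        split_ifs <;> exact ⟨by linarith, by linarith⟩
      | succ a => exact hl a b (by omega)
    · cases a with
      | zero =>
        have := sum_removeEntry x (Nat.lt_succ_iff.1 (hσ 0 (by omega)))
        simp only [consRow, hl0, Nat.sub_zero, zero_add, Nat.add_sub_cancel]
        linarith
      | succ a =>
        have := hw a (by omega)
        rw [removeEntry_removeIndex x (hne a (by omega))] at this
        rw [← this, Nat.add_sub_add_right, Nat.add_sub_add_right]
        rfl

/-- Patterns of types `B` and `C` whose weight is a given signed permutation of the first row. -/
theorem exists_rows_BC (m : ℕ) : ∀ (x : ℕ → ℝ) (σ : ℕ → ℕ) (ε : ℕ → ℝ),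
    (∀ b, b + 1 < m → x (b + 1) ≤ x b) → (∀ b < m, 0 ≤ x b) → (∀ a < m, σ a < m) →
    (∀ a < m, ∀ a' < m, σ a = σ a' → a = a') → (∀ a, ε a = 1 ∨ ε a = -1) →
    ∃ l h : ℕ → ℕ → ℝ, l 0 = x ∧
      (∀ a b, a + b < m → h a b ≤ l a b ∧ (1 ≤ b → h a b ≤ l (a + 1) (b - 1)) ∧
        (a + b + 1 < m → l a (b + 1) ≤ h a b ∧ l (a + 1) b ≤ h a b)) ∧
      (∀ a b, a + b + 1 = m → 0 ≤ h a b) ∧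
      ∀ a < m, ∑ b ∈ Finset.range (m - a), l a b + ∑ b ∈ Finset.range (m - (a + 1)), l (a + 1) b
        - 2 * ∑ b ∈ Finset.range (m - a), h a b = ε a * x (σ a) := by
  induction m with
  | zero => exact fun x σ _ _ _ _ _ _ =>
      ⟨fun _ => x, fun _ => x, rfl, by omega, by omega, by omega⟩
  | succ m ih =>
    intro x σ ε hx hx0 hσ hinj hε
    obtain ⟨hne, hσ', hinj'⟩ := removeIndex_tail hσ hinj
    have hk := hσ 0 (by omega)
    obtain ⟨l, h, hl0, hlh, hh, hw⟩ := ih (removeEntry (σ 0) x)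
      (fun a => removeIndex (σ 0) (σ (a + 1))) (fun a => ε (a + 1)) (removeEntry_anti hx _)
      (fun b hb => by unfold removeEntry; split_ifs <;> exact hx0 _ (by omega)) hσ' hinj'
      fun a => hε _
    have hsum := sum_removeEntry x (Nat.lt_succ_iff.1 hk)
    -- The first row of `η` attains the extreme values of its sum: it is as small as possible for
    -- the weight `x (σ 0)`, and as large as possible for the weight `-x (σ 0)`.
    obtain ⟨h0, h00, h0m, h0w⟩ : ∃ h0 : ℕ → ℝ, (∀ b < m + 1, h0 b ≤ x b ∧
        (1 ≤ b → h0 b ≤ removeEntry (σ 0) x (b - 1)) ∧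
        (b < m → x (b + 1) ≤ h0 b ∧ removeEntry (σ 0) x b ≤ h0 b)) ∧ 0 ≤ h0 m ∧
        ∑ b ∈ Finset.range (m + 1), x b + ∑ b ∈ Finset.range m, removeEntry (σ 0) x b
          - 2 * ∑ b ∈ Finset.range (m + 1), h0 b = ε 0 * x (σ 0) := by
      rcases hε 0 with h1 | h1
      · refine ⟨fun b => if b < m then removeEntry (σ 0) x b else 0, fun b hb => ?_, ?_, ?_⟩
        · refine ⟨?_, fun hb1 => ?_, fun hbm => ?_⟩
          · have := hx0 b hb
            have := fun hb => hx b hb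
            beta_reduce
            unfold removeEntry
            split_ifs <;> first | linarith | exact this (by omega)
          · obtain ⟨b, rfl⟩ : ∃ c, b = c + 1 := ⟨b - 1, by omega⟩
            rw [Nat.add_sub_cancel]
            beta_reduce
            split_ifs with hlt
            · exact removeEntry_anti hx _ b hlt
            · unfold removeEntry; split_ifs <;> exact hx0 _ (by omega)
          · simp only [if_pos hbm, le_refl, and_true]
            have := hx b (by omega)
            unfold removeEntry
            split_ifs <;> linarith
        · simp
        · rw [Finset.sum_range_succ (fun b => if b < m then removeEntry (σ 0) x b else 0),
            Finset.sum_congr rfl fun b hb => if_pos (Finset.mem_range.1 hb), if_neg (by omega), h1]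
          linarith
      · refine ⟨x, fun b hb => ⟨le_rfl, fun hb1 => ?_, fun hbm => ?_⟩, hx0 m (by omega), ?_⟩
        · obtain ⟨b, rfl⟩ : ∃ c, b = c + 1 := ⟨b - 1, by omega⟩
          have := hx b hb
          unfold removeEntry
          split_ifs <;> simp [this]
        · have := hx b (by omega)
          unfold removeEntry
          split_ifs <;> simp [this]
        · rw [h1]; linarith
    refine ⟨consRow x l, consRow h0 h, rfl, fun a b hab => ?_, fun a b hab => ?_, fun a ha => ?_⟩
    · cases a with
      | zero =>
        simp only [consRow, hl0]
        have := h00 b (by omega)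
        exact ⟨this.1, this.2.1, fun hb => this.2.2 (by omega)⟩
      | succ a =>
        have := hlh a b (by omega)
        exact ⟨this.1, this.2.1, fun hb => this.2.2 (by omega)⟩
    · cases a with
      | zero =>
        obtain rfl : b = m := by omega
        exact h0m
      | succ a => exact hh a b (by omega)
    · cases a with
      | zero =>
        simp only [consRow, hl0, Nat.sub_zero, zero_add, Nat.add_sub_cancel]
        exact h0w
      | succ a =>
        have := hw a (by omega)
        rw [removeEntry_removeIndex x (hne a (by omega))] at this
        rw [← this, Nat.add_sub_add_right, Nat.add_sub_add_right]
        rfl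

/-- The sequence `x` with its entry of index `m - 1` multiplied by `t`. With `t = ± 1` this is the
sign change of the last coordinate, which is not in the Weyl group of type `D_m`. -/
def scaleLast (m : ℕ) (t : ℝ) (x : ℕ → ℝ) : ℕ → ℝ := fun b => if b + 1 = m then t * x b else x b

theorem sum_scaleLast (m : ℕ) (t : ℝ) (x : ℕ → ℝ) :
    ∑ b ∈ Finset.range (m + 1), scaleLast (m + 1) t x b =
      ∑ b ∈ Finset.range m, x b + t * x m := by
  rw [Finset.sum_range_succ]
  congr 1
  · refine Finset.sum_congr rfl fun b hb => if_neg ?_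
    have := Finset.mem_range.1 hb
    omega
  · exact if_pos rfl

/-- One row of an extremal pattern of type `D`: the entry `x k` is removed from the row,
contributing `t * x k` to the weight, and the last of the remaining entries is multiplied by
`t = ± 1`. -/
theorem exists_row_D (m : ℕ) (x : ℕ → ℝ) (hx : ∀ b, b + 1 < m + 1 → x (b + 1) ≤ x b)
    (hx' : ∀ b, b + 1 = m → 0 ≤ x b + x (b + 1)) (k : ℕ) (hk : k < m + 1) (t : ℝ)
    (ht : t = 1 ∨ t = -1) (htm : m = 0 → t = 1) :
    ∃ h : ℕ → ℝ, (∀ b < m, h b ≤ x b ∧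
        (1 ≤ b → h b ≤ scaleLast m t (removeEntry k x) (b - 1)) ∧
        x (b + 1) ≤ h b ∧ scaleLast m t (removeEntry k x) b ≤ h b) ∧
      (∀ b, b + 1 = m →
        h b ≤ x (b + 1) + scaleLast m t (removeEntry k x) b + x b ∧
        (1 ≤ b → h b ≤ x (b + 1) + scaleLast m t (removeEntry k x) b
          + scaleLast m t (removeEntry k x) (b - 1))) ∧
      ∑ b ∈ Finset.range (m + 1), x b
        + ∑ b ∈ Finset.range m, scaleLast m t (removeEntry k x) b
        - 2 * ∑ b ∈ Finset.range m, h b = t * x k := by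
  have hsum := sum_removeEntry x (Nat.lt_succ_iff.1 hk)
  rcases ht with rfl | rfl
  · have hs : scaleLast m 1 (removeEntry k x) = removeEntry k x := by
      funext b; simp [scaleLast]
    rw [hs]
    refine ⟨removeEntry k x, fun b hb => ⟨?_, fun hb1 => ?_, ?_, le_rfl⟩,
      fun b hb => ⟨?_, fun hb1 => ?_⟩, by linarith⟩
    · have := hx b (by omega)
      unfold removeEntry; split_ifs <;> linarith
    · obtain ⟨b, rfl⟩ : ∃ c, b = c + 1 := ⟨b - 1, by omega⟩
      exact removeEntry_anti hx k b (by omega)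
    · have := hx b (by omega)
      unfold removeEntry; split_ifs <;> linarith
    · linarith [hx' b hb]
    · obtain ⟨b, rfl⟩ : ∃ c, b = c + 1 := ⟨b - 1, by omega⟩
      have h1 := hx' _ hb
      have h2 := hx b (by omega)
      have h3 := hx (b + 1) (by omega)
      rw [Nat.add_sub_cancel]
      unfold removeEntry; split_ifs <;> linarith
  · obtain ⟨p, rfl⟩ : ∃ p, m = p + 1 :=
      ⟨m - 1, by
        have : m ≠ 0 := fun h0 => by have := htm h0; norm_num at this
        omega⟩
    have hlast := hx' p rfl
    have hp := hx p (by omega)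
    rw [sum_scaleLast]
    -- For `t = -1` the row of `η` is as large as possible: it is `x` without its last entry, unless
    -- `k` is the last index; then `x (p + 1)` takes the place of `x p`, whose sign changes.
    rcases Nat.lt_or_ge k (p + 1) with hkp | hkp
    · refine ⟨x, fun b hb => ⟨le_rfl, fun hb1 => ?_, hx b (by omega), ?_⟩,
        fun b hb => ⟨?_, fun hb1 => ?_⟩, ?_⟩
      · obtain ⟨b, rfl⟩ : ∃ c, b = c + 1 := ⟨b - 1, by omega⟩
        have := hx b (by omega)
        rw [Nat.add_sub_cancel, scaleLast, if_neg (by omega), removeEntry]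
        split_ifs <;> linarith
      · have := hx b (by omega)
        unfold scaleLast removeEntry
        split_ifs with h1 h2
        · omega
        · obtain rfl : b = p := by omega
          linarith
        · exact le_rfl
        · exact this
      · obtain rfl : b = p := by omega
        rw [scaleLast, if_pos rfl, removeEntry, if_neg (by omega)]
        linarith
      · obtain rfl : b = p := by omega
        obtain ⟨b, rfl⟩ : ∃ c, b = c + 1 := ⟨b - 1, by omega⟩
        have := hx b (by omega)
        rw [scaleLast, if_pos rfl, removeEntry, if_neg (by omega), Nat.add_sub_cancel, scaleLast,
          if_neg (by omega), removeEntry]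
        split_ifs <;> linarith
      · have h1 : removeEntry k x p = x (p + 1) := if_neg (by omega)
        rw [Finset.sum_range_succ _ p, h1] at hsum
        rw [h1]
        rw [Finset.sum_range_succ _ (p + 1)] at hsum ⊢
        linarith
    · obtain rfl : k = p + 1 := by omega
      have hr : ∀ b < p + 1, removeEntry (p + 1) x b = x b := fun b hb => if_pos hb
      refine ⟨fun b => if b = p then x (p + 1) else x b, fun b hb => ⟨?_, fun hb1 => ?_, ?_, ?_⟩,
        fun b hb => ⟨?_, fun hb1 => ?_⟩, ?_⟩
      · beta_reduce
        split_ifs with h1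
        · subst h1; exact hp
        · exact le_rfl
      · obtain ⟨b, rfl⟩ : ∃ c, b = c + 1 := ⟨b - 1, by omega⟩
        rw [Nat.add_sub_cancel, scaleLast, if_neg (by omega), hr b (by omega)]
        have := hx b (by omega)
        beta_reduce
        split_ifs with h1
        · subst h1; linarith
        · exact this
      · beta_reduce
        split_ifs with h1
        · rw [h1]
        · exact hx b (by omega)
      · beta_reduce
        unfold scaleLast
        rw [hr b hb]
        split_ifs with h1 h2
        · subst h2; linarith
        · omega
        · omega
        · exact le_rfl
      · obtain rfl : b = p := by omega
        beta_reduce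
        rw [scaleLast, if_pos rfl, hr b (by omega), if_pos rfl]
        linarith
      · obtain rfl : b = p := by omega
        obtain ⟨b, rfl⟩ : ∃ c, b = c + 1 := ⟨b - 1, by omega⟩
        have := hx b (by omega)
        beta_reduce
        rw [scaleLast, if_pos rfl, hr _ (by omega), if_pos rfl, Nat.add_sub_cancel, scaleLast,
          if_neg (by omega), hr _ (by omega)]
        linarith
      · rw [Finset.sum_congr rfl fun b hb => hr b (by have := Finset.mem_range.1 hb; omega),
          hr p (by omega), Finset.sum_range_succ _ (p + 1), Finset.sum_range_succ _ p,
          Finset.sum_range_succ _ p, if_pos rfl,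
          Finset.sum_congr rfl fun b hb => if_neg (by have := Finset.mem_range.1 hb; omega)]
        ring

theorem scaleLast_removeEntry_anti {m : ℕ} {x : ℕ → ℝ}
    (hx : ∀ b, b + 1 < m + 1 → x (b + 1) ≤ x b)
    (hx' : ∀ b, b + 1 = m → 0 ≤ x b + x (b + 1)) {k : ℕ} {t : ℝ}
    (ht : t = 1 ∨ t = -1) :
    (∀ b, b + 1 < m → scaleLast m t (removeEntry k x) (b + 1) ≤
        scaleLast m t (removeEntry k x) b) ∧
      ∀ b, b + 2 = m → 0 ≤ scaleLast m t (removeEntry k x) b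
        + scaleLast m t (removeEntry k x) (b + 1) := by
  have key : ∀ b, b + 2 = m → removeEntry k x (b + 1) ≤ removeEntry k x b ∧
      0 ≤ removeEntry k x b + removeEntry k x (b + 1) := fun b hb => by
    have h1 := hx' (b + 1) (by omega)
    have h2 := hx b (by omega)
    have h3 := hx (b + 1) (by omega)
    unfold removeEntry
    split_ifs <;> first | omega | exact ⟨by linarith, by linarith⟩
  refine ⟨fun b hb => ?_, fun b hb => ?_⟩
  · unfold scaleLast
    rw [if_neg (show ¬ b + 1 = m by omega)]
    split_ifs with h1
    · have := key b h1
      rcases ht with rfl | rfl <;> linarith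
    · exact removeEntry_anti hx k b hb
  · unfold scaleLast
    rw [if_neg (show ¬ b + 1 = m by omega), if_pos (by omega)]
    have := key b hb
    rcases ht with rfl | rfl <;> linarith

theorem prod_sign {ε : ℕ → ℝ} (hε : ∀ a, ε a = 1 ∨ ε a = -1) (m : ℕ) :
    ∏ a ∈ Finset.range m, ε a = 1 ∨ ∏ a ∈ Finset.range m, ε a = -1 := by
  induction m with
  | zero => simp
  | succ m ih =>
    rw [Finset.prod_range_succ]
    rcases ih with h | h <;> rcases hε m with h' | h' <;> rw [h, h'] <;> simp

/-- Patterns of type `D` whose weight is a given signed permutation of the first row, with an even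
number of sign changes. For arbitrary signs `ε`, evenness is enforced by multiplying the last entry
of the first row by the product of all signs. -/
theorem exists_rows_D (m : ℕ) : ∀ (x : ℕ → ℝ) (σ : ℕ → ℕ) (ε : ℕ → ℝ),
    (∀ b, b + 1 < m → x (b + 1) ≤ x b) → (∀ b, b + 2 = m → 0 ≤ x b + x (b + 1)) →
    (∀ a < m, σ a < m) → (∀ a < m, ∀ a' < m, σ a = σ a' → a = a') →
    (∀ a, ε a = 1 ∨ ε a = -1) →
    ∃ l h : ℕ → ℕ → ℝ, l 0 = x ∧
      (∀ a b, a + b + 1 < m → h a b ≤ l a b ∧ (1 ≤ b → h a b ≤ l (a + 1) (b - 1)) ∧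
        l a (b + 1) ≤ h a b ∧ l (a + 1) b ≤ h a b) ∧
      (∀ a b, a + b + 2 = m → h a b ≤ l a (b + 1) + l (a + 1) b + l a b ∧
        (1 ≤ b → h a b ≤ l a (b + 1) + l (a + 1) b + l (a + 1) (b - 1))) ∧
      ∀ a < m, ∑ b ∈ Finset.range (m - a), l a b + ∑ b ∈ Finset.range (m - (a + 1)), l (a + 1) b
        - 2 * ∑ b ∈ Finset.range (m - (a + 1)), h a b
        = ε a * scaleLast m (∏ a ∈ Finset.range m, ε a) x (σ a) := by
  induction m with
  | zero => exact fun x σ _ _ _ _ _ _ =>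
      ⟨fun _ => x, fun _ => x, rfl, by omega, by omega, by omega⟩
  | succ m ih =>
    intro x σ ε hx hx' hσ hinj hε
    obtain ⟨hne, hσ', hinj'⟩ := removeIndex_tail hσ hinj
    have hk := hσ 0 (by omega)
    have hx1 : ∀ b, b + 1 = m → 0 ≤ x b + x (b + 1) := fun b hb => hx' b (by omega)
    set s : ℝ := ∏ a ∈ Finset.range m, ε (a + 1) with hs
    have hs1 : s = 1 ∨ s = -1 := prod_sign (fun a => hε (a + 1)) m
    have hss : s * s = 1 := by rcases hs1 with h | h <;> rw [h] <;> norm_num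
    have hprod : ∏ a ∈ Finset.range (m + 1), ε a = s * ε 0 := Finset.prod_range_succ' _ _
    -- If the last entry itself is removed, its sign `ε 0 * (s * ε 0) = s` goes over to the
    -- last of the remaining entries.
    set t : ℝ := if σ 0 = m then s else ε 0 with ht
    have ht1 : t = 1 ∨ t = -1 := by rw [ht]; split_ifs; exacts [hs1, hε 0]
    obtain ⟨h0, h00, h0m, h0w⟩ := exists_row_D m x hx hx1 (σ 0) hk t ht1 (by
      rintro rfl
      rw [ht, if_pos (by omega), hs, Finset.prod_range_zero])
    obtain ⟨hy, hy'⟩ := scaleLast_removeEntry_anti hx hx1 (k := σ 0) ht1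
    obtain ⟨l, h, hl0, hlh, hh, hw⟩ := ih (scaleLast m t (removeEntry (σ 0) x))
      (fun a => removeIndex (σ 0) (σ (a + 1))) (fun a => ε (a + 1)) hy hy' hσ' hinj'
      fun a => hε _
    refine ⟨consRow x l, consRow h0 h, rfl, fun a b hab => ?_, fun a b hab => ?_, fun a ha => ?_⟩
    · cases a with
      | zero =>
        simp only [consRow, hl0]
        exact h00 b (by omega)
      | succ a => exact hlh a b (by omega)
    · cases a with
      | zero =>
        simp only [consRow, hl0]
        exact h0m b (by omega)
      | succ a => exact hh a b (by omega)
    · rw [hprod]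
      cases a with
      | zero =>
        simp only [consRow, hl0, Nat.sub_zero, zero_add, Nat.add_sub_cancel]
        rw [h0w, ht, scaleLast]
        have : ε 0 * ε 0 = 1 := by rcases hε 0 with h | h <;> rw [h] <;> norm_num
        split_ifs <;> first | omega | rfl | linear_combination (-s * x (σ 0)) * this
      | succ a =>
        have h1 := hw a (by omega)
        have h2 := hne a (by omega)
        have h3 := hσ (a + 1) ha
        have h4 : scaleLast m s (scaleLast m t (removeEntry (σ 0) x))
            (removeIndex (σ 0) (σ (a + 1))) = scaleLast (m + 1) (s * ε 0) x (σ (a + 1)) := by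
          have h5 := removeEntry_removeIndex x h2
          unfold scaleLast
          rw [h5, ht]
          unfold removeIndex
          split_ifs <;> first | omega | rfl | linear_combination (x (σ (a + 1))) * hss | ring
        rw [h4] at h1
        rw [← h1, Nat.add_sub_add_right, Nat.add_sub_add_right]
        rfl

/-! ### From rows to patterns -/

namespace TriArray

/-- The triangular array with entries `f_{i,j} = l (i - 1) (j - i)`; thus `l a` lists the entries of
row `a + 1`, counted from `0`. -/
def ofRows (m : ℕ) (l : ℕ → ℕ → ℝ) : TriArray m := fun p => l (p.1.1 - 1) (p.1.2 - p.1.1)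

theorem entry_ofRows {m : ℕ} (l : ℕ → ℕ → ℝ) {i j a b : ℕ} (hi : i = a + 1) (hj : j = i + b)
    (hm : j ≤ m) : (ofRows m l).entry i j = l a b := by
  subst hi hj
  rw [entry, dif_pos ⟨by omega, by omega, hm⟩, ofRows]
  exact congrArg (l a) (Nat.add_sub_cancel_left _ _)

theorem rowSum_ofRows {m : ℕ} (l : ℕ → ℕ → ℝ) (a : ℕ) :
    (ofRows m l).rowSum (a + 1) = ∑ b ∈ Finset.range (m - a), l a b := by
  have h : Finset.Icc (a + 1) m = Finset.Ico (a + 1) (m + 1) := by ext; simp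
  rw [rowSum, h, Finset.sum_Ico_eq_sum_range, Nat.add_sub_add_right]
  refine Finset.sum_congr rfl fun b hb => entry_ofRows l rfl rfl ?_
  have := Finset.mem_range.1 hb
  omega

theorem entry_add {m : ℕ} (f g : TriArray m) (i j : ℕ) :
    (f + g).entry i j = f.entry i j + g.entry i j := by
  unfold entry; split_ifs <;> simp

theorem entry_smul {m : ℕ} (c : ℝ) (f : TriArray m) (i j : ℕ) :
    (c • f).entry i j = c * f.entry i j := by
  unfold entry; split_ifs <;> simp

theorem rowSum_add {m : ℕ} (f g : TriArray m) (i : ℕ) :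
    (f + g).rowSum i = f.rowSum i + g.rowSum i := by
  simp [rowSum, entry_add, Finset.sum_add_distrib]

theorem rowSum_smul {m : ℕ} (c : ℝ) (f : TriArray m) (i : ℕ) :
    (c • f).rowSum i = c * f.rowSum i := by
  simp [rowSum, entry_smul, Finset.mul_sum]

theorem rowSum_eq_zero {m : ℕ} (f : TriArray m) {i : ℕ} (hi : m < i) : f.rowSum i = 0 := by
  rw [rowSum, Finset.Icc_eq_empty (by omega), Finset.sum_empty]

end TriArray

/-- A vector, continued by `0` to a sequence indexed by `ℕ`. -/
def toSeq {n : ℕ} (v : Fin n → ℝ) : ℕ → ℝ := fun b => if h : b < n then v ⟨b, h⟩ else 0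

@[simp]
theorem toSeq_val {n : ℕ} (v : Fin n → ℝ) (i : Fin n) : toSeq v i = v i := dif_pos i.2

theorem toSeq_of_lt {n : ℕ} (v : Fin n → ℝ) {b : ℕ} (h : b < n) : toSeq v b = v ⟨b, h⟩ := dif_pos h

theorem antitone_of_toSeq {n : ℕ} {v : Fin n → ℝ}
    (h : ∀ b, b + 1 < n → toSeq v (b + 1) ≤ toSeq v b) : Antitone v := by
  have key : ∀ b c, b ≤ c → c < n → toSeq v c ≤ toSeq v b := by
    intro b c hbc
    induction c, hbc using Nat.le_induction with
    | base => exact fun _ => le_rfl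
    | succ c hc ih => exact fun hn => (h c hn).trans (ih (by omega))
  intro i j hij
  simpa using key i j hij j.2

theorem toSeq_succ_le {n : ℕ} {v : Fin n → ℝ} (hv : Antitone v) (b : ℕ) (hb : b + 1 < n) :
    toSeq v (b + 1) ≤ toSeq v b := by
  rw [toSeq_of_lt v hb, toSeq_of_lt v (show b < n by omega)]
  exact hv (Fin.mk_le_mk.2 (by omega))

/-- A permutation of `Fin n`, as a function on `ℕ`. -/
def permSeq {n : ℕ} (σ : Equiv.Perm (Fin n)) : ℕ → ℕ := fun a => if h : a < n then σ ⟨a, h⟩ else 0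

theorem permSeq_val {n : ℕ} (σ : Equiv.Perm (Fin n)) (i : Fin n) : permSeq σ i = σ i := dif_pos i.2

theorem permSeq_lt {n : ℕ} (σ : Equiv.Perm (Fin n)) (a : ℕ) (ha : a < n) : permSeq σ a < n := by
  rw [permSeq, dif_pos ha]; exact (σ _).2

theorem permSeq_inj {n : ℕ} (σ : Equiv.Perm (Fin n)) (a : ℕ) (ha : a < n) (a' : ℕ) (ha' : a' < n)
    (h : permSeq σ a = permSeq σ a') : a = a' := by
  rw [permSeq, permSeq, dif_pos ha, dif_pos ha'] at h
  simpa using σ.injective (Fin.ext h)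

/-- A family of signs indexed by `Fin n`, continued by `1` to a sequence. -/
def signSeq {n : ℕ} (ε : Fin n → ℝ) : ℕ → ℝ := fun a => if h : a < n then ε ⟨a, h⟩ else 1

theorem signSeq_val {n : ℕ} (ε : Fin n → ℝ) (i : Fin n) : signSeq ε i = ε i := dif_pos i.2

theorem signSeq_eq {n : ℕ} {ε : Fin n → ℝ} (hε : ∀ i, ε i = 1 ∨ ε i = -1) (a : ℕ) :
    signSeq ε a = 1 ∨ signSeq ε a = -1 := by
  unfold signSeq
  split_ifs
  exacts [hε _, Or.inl rfl]

/-- The vector `v` with its last coordinate multiplied by `t`. -/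
def scaleLastCoord {n : ℕ} (t : ℝ) (v : Fin n → ℝ) : Fin n → ℝ :=
  fun i => if (i : ℕ) + 1 = n then t * v i else v i

namespace ClassicalType

open TriArray

theorem exists_pattern_A {n : ℕ} {lam : Fin n → ℝ}
    (hlam : ∀ b, b + 1 < n → toSeq lam (b + 1) ≤ toSeq lam b) (σ : Equiv.Perm (Fin n)) :
    ∃ l : TriArray n, GTInequalities l ∧ (∀ k : Fin n, l.entry 1 ((k : ℕ) + 1) = lam k) ∧
      ∀ k : Fin n, l.rowSum ((k : ℕ) + 1) - l.rowSum ((k : ℕ) + 2) = lam (σ k) := by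
  obtain ⟨l, hl0, hl, hw⟩ := exists_rows_A n (toSeq lam) (permSeq σ) hlam (permSeq_lt σ)
    (permSeq_inj σ)
  refine ⟨ofRows n l, fun i j hi hij hj => ?_, fun k => ?_, fun i => ?_⟩
  · obtain ⟨a, rfl⟩ : ∃ a, i = a + 1 := ⟨i - 1, by omega⟩
    obtain ⟨b, rfl⟩ := Nat.exists_eq_add_of_le hij
    rw [entry_ofRows l (i := a + 1 + 1) (a := a + 1) (b := b) (by omega) (by omega) (by omega),
      entry_ofRows l (a := a) (b := b) (by omega) (by omega) (by omega),
      entry_ofRows l (a := a) (b := b + 1) (by omega) (by omega) (by omega)]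
    exact hl a b (by omega)
  · rw [entry_ofRows l (a := 0) (b := k) (by omega) (by omega) k.2, hl0, toSeq_val]
  · have := hw i i.2
    rw [permSeq_val, toSeq_val] at this
    rw [rowSum_ofRows, rowSum_ofRows, ← this]

theorem exists_pattern_BC {r : ℕ} {lam : Fin r → ℝ}
    (hlam : ∀ b, b + 1 < r → toSeq lam (b + 1) ≤ toSeq lam b) (hlam0 : ∀ i, 0 ≤ lam i)
    (σ : Equiv.Perm (Fin r)) {ε : Fin r → ℝ} (hε : ∀ i, ε i = 1 ∨ ε i = -1) :
    ∃ l η : TriArray r, (BZInequalities l η ∧ NonnegInequalities r η) ∧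
      (∀ k : Fin r, l.entry 1 ((k : ℕ) + 1) = lam k) ∧
      ∀ k : Fin r, l.rowSum ((k : ℕ) + 1) + l.rowSum ((k : ℕ) + 2) - 2 * η.rowSum ((k : ℕ) + 1)
        = ε k * lam (σ k) := by
  obtain ⟨l, h, hl0, hl, hh, hw⟩ := exists_rows_BC r (toSeq lam) (permSeq σ) (signSeq ε) hlam
    (fun b hb => by rw [toSeq_of_lt lam hb]; exact hlam0 _)
    (permSeq_lt σ) (permSeq_inj σ) (signSeq_eq hε)
  refine ⟨ofRows r l, ofRows r h, ⟨fun i j hi hij hj => ?_, fun i hi hir => ?_⟩, fun k => ?_,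
    fun i => ?_⟩
  · obtain ⟨a, rfl⟩ : ∃ a, i = a + 1 := ⟨i - 1, by omega⟩
    obtain ⟨b, rfl⟩ := Nat.exists_eq_add_of_le hij
    have := hl a b (by omega)
    rw [entry_ofRows h (a := a) (b := b) (by omega) (by omega) (by omega),
      entry_ofRows l (a := a) (b := b) (by omega) (by omega) (by omega)]
    refine ⟨this.1, fun hb => ?_, fun hb => ?_⟩
    · rw [entry_ofRows l (a := a + 1) (b := b - 1) (by omega) (by omega) (by omega)]
      exact this.2.1 (by omega)
    · rw [entry_ofRows l (i := a + 1 + 1) (a := a + 1) (b := b) (by omega) (by omega) (by omega),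
        entry_ofRows l (a := a) (b := b + 1) (by omega) (by omega) (by omega)]
      exact this.2.2 (by omega)
  · rw [entry_ofRows h (a := i - 1) (b := r - i) (by omega) (by omega) (by omega)]
    exact hh _ _ (by omega)
  · rw [entry_ofRows l (a := 0) (b := k) (by omega) (by omega) k.2, hl0, toSeq_val]
  · have := hw i i.2
    rw [permSeq_val, toSeq_val, signSeq_val] at this
    rw [rowSum_ofRows, rowSum_ofRows, rowSum_ofRows, ← this]

theorem exists_pattern_D {r : ℕ} {lam : Fin r → ℝ}
    (hlam : ∀ b, b + 1 < r → toSeq lam (b + 1) ≤ toSeq lam b)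
    (hlam' : ∀ b, b + 2 = r → 0 ≤ toSeq lam b + toSeq lam (b + 1))
    (σ : Equiv.Perm (Fin r)) {ε : Fin r → ℝ} (hε : ∀ i, ε i = 1 ∨ ε i = -1) :
    ∃ (l : TriArray r) (η : TriArray (r - 1)), (BZInequalities l η ∧ TypeDInequalities r l η) ∧
      (∀ k : Fin r, l.entry 1 ((k : ℕ) + 1) = lam k) ∧
      ∀ k : Fin r, l.rowSum ((k : ℕ) + 1) + l.rowSum ((k : ℕ) + 2) - 2 * η.rowSum ((k : ℕ) + 1)
        = ε k * scaleLastCoord (∏ i, ε i) lam (σ k) := by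
  obtain ⟨l, h, hl0, hl, hh, hw⟩ := exists_rows_D r (toSeq lam) (permSeq σ) (signSeq ε) hlam
    hlam' (permSeq_lt σ) (permSeq_inj σ) (signSeq_eq hε)
  refine ⟨ofRows r l, ofRows (r - 1) h, ⟨fun i j hi hij hj => ?_, fun i hi hir => ?_⟩, fun k => ?_,
    fun i => ?_⟩
  · obtain ⟨a, rfl⟩ : ∃ a, i = a + 1 := ⟨i - 1, by omega⟩
    obtain ⟨b, rfl⟩ := Nat.exists_eq_add_of_le hij
    have := hl a b (by omega)
    rw [entry_ofRows h (a := a) (b := b) (by omega) (by omega) (by omega),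
      entry_ofRows l (a := a) (b := b) (by omega) (by omega) (by omega)]
    refine ⟨this.1, fun hb => ?_, fun hb => ?_⟩
    · rw [entry_ofRows l (a := a + 1) (b := b - 1) (by omega) (by omega) (by omega)]
      exact this.2.1 (by omega)
    · rw [entry_ofRows l (i := a + 1 + 1) (a := a + 1) (b := b) (by omega) (by omega) (by omega),
        entry_ofRows l (a := a) (b := b + 1) (by omega) (by omega) (by omega)]
      exact this.2.2
  · obtain ⟨a, rfl⟩ : ∃ a, i = a + 1 := ⟨i - 1, by omega⟩
    obtain ⟨b, rfl⟩ : ∃ b, r = a + b + 2 := ⟨r - a - 2, by omega⟩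
    have := hh a b rfl
    rw [entry_ofRows h (a := a) (b := b) (by omega) (by omega) (by omega),
      entry_ofRows l (a := a) (b := b + 1) (by omega) (by omega) (by omega),
      entry_ofRows l (a := a + 1) (b := b) (by omega) (by omega) (by omega),
      entry_ofRows l (a := a) (b := b) (by omega) (by omega) (by omega)]
    refine ⟨this.1, fun hb => ?_⟩
    rw [entry_ofRows l (a := a + 1) (b := b - 1) (by omega) (by omega) (by omega)]
    exact this.2 (by omega)
  · rw [entry_ofRows l (a := 0) (b := k) (by omega) (by omega) k.2, hl0, toSeq_val]
  · have := hw i i.2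
    have hprod : ∏ a ∈ Finset.range r, signSeq ε a = ∏ i, ε i := by
      rw [Finset.prod_range]
      exact Finset.prod_congr rfl fun i _ => signSeq_val ε i
    rw [permSeq_val, signSeq_val, hprod, scaleLast, toSeq_val] at this
    rw [rowSum_ofRows, rowSum_ofRows, rowSum_ofRows, scaleLastCoord, ← this, Nat.sub_sub,
      Nat.add_comm 1]

/-- The weight of a Gelfand-Tsetlin pattern, as a linear map. -/
def gtWeightMap (n m : ℕ) : TriArray n × TriArray m →ₗ[ℝ] Fin n → ℝ where
  toFun T k := T.1.rowSum ((k : ℕ) + 1) - T.1.rowSum ((k : ℕ) + 2)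
  map_add' S T := by
    funext k
    simp only [Prod.fst_add, rowSum_add, Pi.add_apply]
    ring
  map_smul' c T := by
    funext k
    simp only [Prod.smul_fst, rowSum_smul, Pi.smul_apply, smul_eq_mul, RingHom.id_apply]
    ring

/-- The weight of a pattern of type `B`, `C` or `D`, as a linear map. -/
def bzWeightMap (n m : ℕ) : TriArray n × TriArray m →ₗ[ℝ] Fin n → ℝ where
  toFun T k := T.1.rowSum ((k : ℕ) + 1) + T.1.rowSum ((k : ℕ) + 2) - 2 * T.2.rowSum ((k : ℕ) + 1)
  map_add' S T := by
    funext k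
    simp only [Prod.fst_add, Prod.snd_add, rowSum_add, Pi.add_apply]
    ring
  map_smul' c T := by
    funext k
    simp only [Prod.smul_fst, Prod.smul_snd, rowSum_smul, Pi.smul_apply, smul_eq_mul,
      RingHom.id_apply]
    ring

/-- `patternWeight`, as a linear map. -/
def weightMap : (X : ClassicalType) → (r : ℕ) → PatternSpace X r →ₗ[ℝ] Weight X r
  | A, r => gtWeightMap (r + 1) 0
  | B, r => bzWeightMap r r
  | C, r => bzWeightMap r r
  | D, r => bzWeightMap r (r - 1)

theorem weightMap_apply (X : ClassicalType) (r : ℕ) (T : PatternSpace X r) :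
    weightMap X r T = patternWeight X r T := by
  cases X <;> rfl

theorem convex_BZInequalities (n m : ℕ) :
    Convex ℝ {T : TriArray n × TriArray m | BZInequalities T.1 T.2} := by
  rintro S hS T hT a b ha hb - i j hi hij hj
  obtain ⟨h1, h2, h3⟩ := hS i j hi hij hj
  obtain ⟨h1', h2', h3'⟩ := hT i j hi hij hj
  simp only [Prod.fst_add, Prod.snd_add, Prod.smul_fst, Prod.smul_snd, entry_add, entry_smul]
  exact ⟨by gcongr, fun h => add_le_add (mul_le_mul_of_nonneg_left (h2 h) ha)
      (mul_le_mul_of_nonneg_left (h2' h) hb),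
    fun h => ⟨add_le_add (mul_le_mul_of_nonneg_left (h3 h).1 ha)
      (mul_le_mul_of_nonneg_left (h3' h).1 hb),
      add_le_add (mul_le_mul_of_nonneg_left (h3 h).2 ha)
      (mul_le_mul_of_nonneg_left (h3' h).2 hb)⟩⟩

theorem convex_GTInequalities (n m : ℕ) :
    Convex ℝ {T : TriArray n × TriArray m | GTInequalities T.1} := by
  rintro S hS T hT a b ha hb - i j hi hij hj
  obtain ⟨h1, h2⟩ := hS i j hi hij hj
  obtain ⟨h1', h2'⟩ := hT i j hi hij hj
  simp only [Prod.fst_add, Prod.smul_fst, entry_add, entry_smul]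
  exact ⟨by gcongr, by gcongr⟩

theorem convex_NonnegInequalities (n r : ℕ) :
    Convex ℝ {T : TriArray n × TriArray r | NonnegInequalities r T.2} := by
  rintro S hS T hT a b ha hb - i hi hir
  have h1 := hS i hi hir
  have h2 := hT i hi hir
  simp only [Prod.snd_add, Prod.smul_snd, entry_add, entry_smul]
  positivity

theorem convex_TypeDInequalities (r : ℕ) :
    Convex ℝ {T : TriArray r × TriArray (r - 1) | TypeDInequalities r T.1 T.2} := by
  rintro S hS T hT a b ha hb - i hi hir
  obtain ⟨h1, h2⟩ := hS i hi hir
  obtain ⟨h1', h2'⟩ := hT i hi hir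
  simp only [Prod.fst_add, Prod.snd_add, Prod.smul_fst, Prod.smul_snd, entry_add, entry_smul]
  refine ⟨?_, fun h => ?_⟩
  · linarith [mul_le_mul_of_nonneg_left h1 ha, mul_le_mul_of_nonneg_left h1' hb]
  · linarith [mul_le_mul_of_nonneg_left (h2 h) ha, mul_le_mul_of_nonneg_left (h2' h) hb]

theorem convex_BZ (X : ClassicalType) (r : ℕ) (lam : Weight X r) : Convex ℝ (BZ X r lam) := by
  have hpat : Convex ℝ {T | IsPattern X r T} := by
    cases X
    · exact convex_GTInequalities (r + 1) 0
    · exact (convex_BZInequalities r r).inter (convex_NonnegInequalities r r)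
    · exact (convex_BZInequalities r r).inter (convex_NonnegInequalities r r)
    · exact (convex_BZInequalities r (r - 1)).inter (convex_TypeDInequalities r)
  refine hpat.inter ?_
  rintro S hS T hT a b - - hab k
  rw [Prod.fst_add, Prod.smul_fst, Prod.smul_fst, entry_add, entry_smul, entry_smul, hS k, hT k,
    ← add_mul, hab, one_mul]

end ClassicalType

/-! ### Dominant chambers and rearrangement -/

/-- Every real family is carried by a permutation to an antitone one. -/
theorem exists_perm_antitone {n : ℕ} (f : Fin n → ℝ) :
    ∃ (σ : Equiv.Perm (Fin n)) (g : Fin n → ℝ), Antitone g ∧ ∀ i, f i = g (σ i) := by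
  refine ⟨(Tuple.sort (-f)).symm, f ∘ Tuple.sort (-f), fun i j hij => ?_, fun i => by simp⟩
  have := Tuple.monotone_sort (-f) hij
  simpa using this

/-- Rearrangement inequality. -/
theorem dotProduct_comp_perm_le {n : ℕ} {g v : Fin n → ℝ} (hg : Antitone g) (hv : Antitone v)
    (σ : Equiv.Perm (Fin n)) : (fun i => g (σ i)) ⬝ᵥ v ≤ g ⬝ᵥ v :=
  (hg.monovary hv).sum_comp_perm_mul_le_sum_mul

theorem dotProduct_comp_perm {n : ℕ} (g v : Fin n → ℝ) (σ : Equiv.Perm (Fin n)) :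
    (fun i => g (σ i)) ⬝ᵥ (fun i => v (σ i)) = g ⬝ᵥ v :=
  Equiv.sum_comp σ fun i => g i * v i

/-- The sign of each entry of `f`, with the sign of `0` being `1`. -/
noncomputable def signs {n : ℕ} (f : Fin n → ℝ) : Fin n → ℝ := fun i => if 0 ≤ f i then 1 else -1

theorem signs_eq {n : ℕ} (f : Fin n → ℝ) (i : Fin n) : signs f i = 1 ∨ signs f i = -1 := by
  unfold signs; split_ifs <;> simp

theorem prod_signs_eq {n : ℕ} (f : Fin n → ℝ) : ∏ i, signs f i = 1 ∨ ∏ i, signs f i = -1 := by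
  have h := prod_sign (signSeq_eq (signs_eq f)) n
  rwa [Finset.prod_range, Finset.prod_congr rfl fun i _ => signSeq_val (signs f) i] at h

theorem signs_mul_abs {n : ℕ} (f : Fin n → ℝ) (i : Fin n) : signs f i * |f i| = f i := by
  unfold signs
  split_ifs with h
  · rw [abs_of_nonneg h, one_mul]
  · rw [abs_of_neg (not_le.1 h)]; ring

theorem mul_signs {n : ℕ} (f : Fin n → ℝ) (i : Fin n) : f i * signs f i = |f i| := by
  unfold signs
  split_ifs with h
  · rw [abs_of_nonneg h, mul_one]
  · rw [abs_of_neg (not_le.1 h)]; ring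

theorem dotProduct_e {n : ℕ} (v : Fin n → ℝ) (k : ℕ) :
    v ⬝ᵥ ClassicalType.e n (k + 1) = toSeq v k := by
  unfold toSeq
  split_ifs with h
  · rw [dotProduct, Finset.sum_eq_single_of_mem (⟨k, h⟩ : Fin n) (Finset.mem_univ _)]
    · simp [ClassicalType.e]
    · intro j _ hj
      have : (j : ℕ) ≠ k := fun h' => hj (Fin.ext h')
      simp [ClassicalType.e, this]
  · refine Finset.sum_eq_zero fun j _ => ?_
    have : (j : ℕ) ≠ k := by have := j.2; omega
    simp [ClassicalType.e, this]

theorem dotProduct_e_sub_e {n : ℕ} (v : Fin n → ℝ) (k : ℕ) :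
    v ⬝ᵥ (ClassicalType.e n (k + 1) - ClassicalType.e n (k + 1 + 1)) =
      toSeq v k - toSeq v (k + 1) := by
  rw [dotProduct_sub, dotProduct_e, dotProduct_e]

namespace ClassicalType

/-- A vector lies in the closed dominant Weyl chamber if its inner products with the simple roots
are nonnegative. -/
def InChamber (X : ClassicalType) (r : ℕ) (v : Weight X r) : Prop :=
  ∀ i, 0 ≤ v ⬝ᵥ simpleRoot X r i

theorem IsDominant.inChamber {X : ClassicalType} {r : ℕ} {v : Weight X r}
    (hv : IsDominant X r v) : InChamber X r v := by
  intro i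
  obtain ⟨d, hd⟩ := hv i
  by_contra! hneg
  have h0 : 0 ≤ simpleRoot X r i ⬝ᵥ simpleRoot X r i :=
    Finset.sum_nonneg fun j _ => mul_self_nonneg _
  rcases h0.eq_or_lt with h | h
  · rw [dotProduct_self_eq_zero.1 h.symm, dotProduct_zero] at hneg
    exact lt_irrefl _ hneg
  · have : corootPairing X r v i < 0 := div_neg_of_neg_of_pos (by linarith) h
    rw [hd] at this
    exact absurd this (not_lt.2 (Nat.cast_nonneg d))

theorem inChamber_A {r : ℕ} (v : Fin (r + 1) → ℝ) :
    InChamber A r v ↔ ∀ b, b + 1 < r + 1 → toSeq v (b + 1) ≤ toSeq v b := by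
  have key : ∀ i : Fin r, v ⬝ᵥ simpleRoot A r i = toSeq v i - toSeq v (i + 1) := fun i =>
    dotProduct_e_sub_e v i
  refine ⟨fun h b hb => ?_, fun h i => ?_⟩
  · have := (h ⟨b, by omega⟩).trans_eq (key _)
    exact sub_nonneg.1 this
  · exact (sub_nonneg.2 (h i (by omega))).trans_eq (key i).symm

/-- The dominant chambers of types `B`, `C` and `D` are cut out by the inequalities between
consecutive coordinates, and the inequality given by the last simple root. -/
theorem inChamber_iff_of_last {X : ClassicalType} {r : ℕ}
    (hroot : ∀ k, k + 1 < r → simpleRootAt X r (k + 1)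
      = e (X.ambientDim r) (k + 1) - e (X.ambientDim r) (k + 1 + 1))
    (v : Weight X r) :
    InChamber X r v ↔ (∀ b, b + 1 < r → toSeq v (b + 1) ≤ toSeq v b) ∧
      ∀ b, b + 1 = r → 0 ≤ v ⬝ᵥ simpleRootAt X r r := by
  constructor
  · refine fun h => ⟨fun b hb => ?_, fun b hb => ?_⟩
    · have := h ⟨b, by omega⟩
      rw [simpleRoot, hroot b hb, dotProduct_e_sub_e] at this
      exact sub_nonneg.1 this
    · have := h ⟨b, by omega⟩
      rwa [simpleRoot, show ((⟨b, by omega⟩ : Fin r) : ℕ) + 1 = r from hb] at this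
  · rintro ⟨h, h'⟩ i
    rcases Nat.lt_or_ge (i + 1) r with hi | hi
    · rw [simpleRoot, hroot i hi, dotProduct_e_sub_e]
      exact sub_nonneg.2 (h i hi)
    · have hir : (i : ℕ) + 1 = r := by omega
      have := h' i hir
      rwa [simpleRoot, hir]

theorem inChamber_B {r : ℕ} (v : Fin r → ℝ) :
    InChamber B r v ↔ (∀ b, b + 1 < r → toSeq v (b + 1) ≤ toSeq v b) ∧
      ∀ b, b + 1 = r → 0 ≤ toSeq v b := by
  refine (inChamber_iff_of_last (X := B) (r := r) (fun k hk => if_pos hk) v).trans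
    (and_congr_right fun _ => forall₂_congr fun b hb => ?_)
  subst hb
  rw [← dotProduct_e]
  exact iff_of_eq (congrArg (fun u => 0 ≤ v ⬝ᵥ u) (if_neg (lt_irrefl _)))

theorem inChamber_C {r : ℕ} (v : Fin r → ℝ) :
    InChamber C r v ↔ (∀ b, b + 1 < r → toSeq v (b + 1) ≤ toSeq v b) ∧
      ∀ b, b + 1 = r → 0 ≤ toSeq v b := by
  refine (inChamber_iff_of_last (X := C) (r := r) (fun k hk => if_pos hk) v).trans
    (and_congr_right fun _ => forall₂_congr fun b hb => ?_)
  subst hb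
  have h : (0 ≤ v ⬝ᵥ ((2 : ℝ) • e (b + 1) (b + 1))) ↔ 0 ≤ toSeq v b := by
    rw [dotProduct_smul, dotProduct_e, smul_eq_mul]
    exact mul_nonneg_iff_of_pos_left two_pos
  exact (iff_of_eq (congrArg (fun u => 0 ≤ v ⬝ᵥ u) (if_neg (lt_irrefl _)))).trans h

theorem inChamber_D {r : ℕ} (hr : 2 ≤ r) (v : Fin r → ℝ) :
    InChamber D r v ↔ (∀ b, b + 1 < r → toSeq v (b + 1) ≤ toSeq v b) ∧
      ∀ b, b + 2 = r → 0 ≤ toSeq v b + toSeq v (b + 1) := by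
  obtain ⟨p, rfl⟩ : ∃ p, r = p + 2 := ⟨r - 2, by omega⟩
  refine (inChamber_iff_of_last (X := D) (r := (p + 2)) (fun k hk => if_pos hk) v).trans
    (and_congr_right fun _ => ?_)
  have h : v ⬝ᵥ simpleRootAt D (p + 2) (p + 2) = toSeq v p + toSeq v (p + 1) := by
    rw [← dotProduct_e, ← dotProduct_e, ← dotProduct_add]
    exact congrArg (fun u => v ⬝ᵥ u) (if_neg (lt_irrefl _))
  constructor
  · intro h' b hb
    obtain rfl : b = p := by omega
    exact (h' (b + 1) rfl).trans_eq h
  · intro h' b hb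
    exact (h' p rfl).trans_eq h.symm

theorem exists_pos_of_not_inChamber_neg {X : ClassicalType} {r : ℕ} {v : Weight X r}
    (h : ¬ InChamber X r (-v)) : ∃ i, 0 < v ⬝ᵥ simpleRoot X r i := by
  by_contra! hall
  refine h fun i => ?_
  rw [neg_dotProduct]
  exact neg_nonneg.2 (hall i)

/-- In type `A`, a functional `f` that is not constant is sorted to a dominant `g`, and some pattern
of weight in the Weyl group orbit of `lam` attains `⟨g, lam⟩` as its `f`-value. -/
theorem exists_chamber_pattern_A {r : ℕ} {lam : Fin (r + 1) → ℝ} (hlam : InChamber A r lam)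
    (f : Fin (r + 1) → ℝ) :
    ∃ g : Fin (r + 1) → ℝ, InChamber A r g ∧ (InChamber A r (-g) → ∀ i, f i = f 0) ∧
      (∀ mu : Fin (r + 1) → ℝ, InChamber A r mu → f ⬝ᵥ mu ≤ g ⬝ᵥ mu) ∧
      ∃ T ∈ BZ A r lam, f ⬝ᵥ gtWeightMap (r + 1) 0 T = g ⬝ᵥ lam := by
  obtain ⟨σ, g, hg, hfg⟩ := exists_perm_antitone f
  refine ⟨g, (inChamber_A g).2 (toSeq_succ_le hg), fun hneg i => ?_, fun mu hmu => ?_, ?_⟩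
  · have hanti := antitone_of_toSeq ((inChamber_A (-g)).1 hneg)
    have key : ∀ j, g j = g 0 := fun j =>
      le_antisymm (hg (Fin.zero_le j)) (neg_le_neg_iff.1 (hanti (Fin.zero_le j)))
    rw [hfg, hfg, key, key (σ 0)]
  · rw [show f = fun i => g (σ i) from funext hfg]
    exact dotProduct_comp_perm_le hg (antitone_of_toSeq ((inChamber_A mu).1 hmu)) σ
  · obtain ⟨l, h1, h2, h3⟩ := exists_pattern_A ((inChamber_A lam).1 hlam) σ
    refine ⟨(l, fun _ => 0), ⟨h1, h2⟩, ?_⟩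
    rw [← dotProduct_comp_perm g lam σ, ← funext hfg]
    exact congrArg (f ⬝ᵥ ·) (funext h3)

theorem nonneg_of_toSeq {n : ℕ} {v : Fin n → ℝ}
    (h : ∀ b, b + 1 < n → toSeq v (b + 1) ≤ toSeq v b) (h0 : ∀ b, b + 1 = n → 0 ≤ toSeq v b)
    (i : Fin n) : 0 ≤ v i := by
  obtain ⟨p, rfl⟩ : ∃ p, n = p + 1 := ⟨n - 1, by have := i.2; omega⟩
  have h1 := h0 p rfl
  rw [toSeq_of_lt v (Nat.lt_succ_self p)] at h1
  exact h1.trans (antitone_of_toSeq h (Fin.le_last i))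

/-- The analogue of `exists_chamber_pattern_A` in types `B` and `C`, which have the same chamber and
the same patterns: the dominant `g` lists the absolute values of the entries of `f`. -/
theorem exists_chamber_pattern_BC {r : ℕ} {lam : Fin r → ℝ}
    (hlam : InChamber B r lam) (f : Fin r → ℝ) :
    ∃ g : Fin r → ℝ, InChamber B r g ∧ (InChamber B r (-g) → f = 0) ∧
      (∀ mu : Fin r → ℝ, InChamber B r mu → f ⬝ᵥ mu ≤ g ⬝ᵥ mu) ∧
      ∃ T ∈ BZ B r lam, f ⬝ᵥ bzWeightMap r r T = g ⬝ᵥ lam := by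
  obtain ⟨σ, g, hg, hfg⟩ := exists_perm_antitone fun i => |f i|
  have hg0 : ∀ i, 0 ≤ g i := fun i => by
    obtain ⟨j, rfl⟩ := σ.surjective i
    rw [← hfg]
    exact abs_nonneg _
  refine ⟨g, (inChamber_B g).2 ⟨toSeq_succ_le hg, fun b hb => ?_⟩, fun hneg => ?_,
    fun mu hmu => ?_, ?_⟩
  · rw [toSeq_of_lt g (by omega)]
    exact hg0 _
  · obtain ⟨h1, h2⟩ := (inChamber_B (-g)).1 hneg
    funext i
    have h3 := nonneg_of_toSeq h1 h2 (σ i)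
    rw [Pi.neg_apply, ← hfg] at h3
    exact abs_nonpos_iff.1 (neg_nonneg.1 h3)
  · obtain ⟨h1, h2⟩ := (inChamber_B mu).1 hmu
    have hmu0 := nonneg_of_toSeq h1 h2
    refine le_trans ?_ (dotProduct_comp_perm_le hg (antitone_of_toSeq h1) σ)
    rw [← funext hfg]
    exact Finset.sum_le_sum fun i _ => mul_le_mul_of_nonneg_right (le_abs_self _) (hmu0 i)
  · obtain ⟨h1, h2⟩ := (inChamber_B lam).1 hlam
    obtain ⟨l, η, h3, h4, h5⟩ := exists_pattern_BC h1 (nonneg_of_toSeq h1 h2) σ (signs_eq f)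
    refine ⟨(l, η), ⟨h3, h4⟩, ?_⟩
    rw [← dotProduct_comp_perm g lam σ, ← funext hfg]
    refine Finset.sum_congr rfl fun i _ => (congrArg (f i * ·) (h5 i)).trans ?_
    beta_reduce
    rw [← mul_assoc, mul_signs]

/-- In the dominant chamber of type `D` all entries but the last are nonnegative, and the absolute
values of the entries decrease. -/
theorem nonneg_and_antitone_abs {p : ℕ} {v : Fin (p + 2) → ℝ}
    (h1 : ∀ b, b + 1 < p + 2 → toSeq v (b + 1) ≤ toSeq v b)
    (h2 : ∀ b, b + 2 = p + 2 → 0 ≤ toSeq v b + toSeq v (b + 1)) :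
    (∀ i : Fin (p + 2), (i : ℕ) + 1 < p + 2 → 0 ≤ v i) ∧ Antitone fun i => |v i| := by
  have hp : |v ⟨p + 1, by omega⟩| ≤ v ⟨p, by omega⟩ := by
    have h3 := h1 p (by omega)
    have h4 := h2 p rfl
    rw [toSeq_of_lt v (b := p) (by omega), toSeq_of_lt v (b := p + 1) (by omega)] at h3 h4
    exact abs_le.2 ⟨by linarith, h3⟩
  have hanti := antitone_of_toSeq h1
  have hle : ∀ i : Fin (p + 2), (i : ℕ) + 1 < p + 2 → |v (Fin.last (p + 1))| ≤ v i := fun i hi =>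
    hp.trans (hanti (Fin.mk_le_mk.2 (by omega)))
  have hnn : ∀ i : Fin (p + 2), (i : ℕ) + 1 < p + 2 → 0 ≤ v i := fun i hi =>
    (abs_nonneg _).trans (hle i hi)
  refine ⟨hnn, fun i j hij => ?_⟩
  have hij' : (i : ℕ) ≤ j := hij
  rcases Nat.lt_or_ge (j + 1) (p + 2) with hj | hj
  · simp only [abs_of_nonneg (hnn i (by omega)), abs_of_nonneg (hnn j hj)]
    exact hanti hij
  · obtain rfl : j = Fin.last (p + 1) := Fin.ext (by simp; omega)
    rcases Nat.lt_or_ge (i + 1) (p + 2) with hi | hi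
    · simp only [abs_of_nonneg (hnn i hi)]
      exact hle i hi
    · obtain rfl : i = Fin.last (p + 1) := Fin.ext (by simp; omega)
      exact le_rfl

theorem dotProduct_scaleLastCoord {n : ℕ} (t : ℝ) (u v : Fin n → ℝ) :
    u ⬝ᵥ scaleLastCoord t v = scaleLastCoord t u ⬝ᵥ v := by
  refine Finset.sum_congr rfl fun i _ => ?_
  unfold scaleLastCoord
  split_ifs <;> ring

/-- The bound on a signed permutation of a dominant weight of type `D`. If the entry of `mu` of
smallest absolute value has the wrong sign in the sorted product, then some entry also
has the wrong sign in the unsorted product, and costs at least as much. -/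
theorem dotProduct_le_scaleLastCoord {p : ℕ} {f g mu : Fin (p + 2) → ℝ}
    {σ : Equiv.Perm (Fin (p + 2))} (hg : Antitone g) (hfg : ∀ i, |f i| = g (σ i))
    (hmu : ∀ i : Fin (p + 2), (i : ℕ) + 1 < p + 2 → 0 ≤ mu i) (hmu' : Antitone fun i => |mu i|) :
    f ⬝ᵥ mu ≤ scaleLastCoord (∏ i, signs f i) g ⬝ᵥ mu := by
  set s : ℝ := ∏ i, signs f i with hs
  have hs1 : s = 1 ∨ s = -1 := prod_signs_eq f
  have hg0 : ∀ i, 0 ≤ g i := fun i => by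
    obtain ⟨j, rfl⟩ := σ.surjective i
    rw [← hfg]
    exact abs_nonneg _
  set L := Fin.last (p + 1) with hL
  have hsort : ∑ i, |f i| * |mu i| ≤ ∑ i, g i * |mu i| := by
    have := dotProduct_comp_perm_le hg hmu' σ
    rwa [← funext hfg] at this
  have hlast : ∀ i, g L * |mu L| ≤ |f i| * |mu i| := fun i => by
    rw [hfg]
    exact mul_le_mul (hg (Fin.le_last _)) (hmu' (Fin.le_last i)) (abs_nonneg _) (hg0 _)
  have hrhs : scaleLastCoord s g ⬝ᵥ mu =
      ∑ i, g i * |mu i| - (g L * |mu L| - s * g L * mu L) := by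
    rw [dotProduct, Fin.sum_univ_castSucc, Fin.sum_univ_castSucc (fun i => g i * |mu i|)]
    have h1 : ∀ i : Fin (p + 1), scaleLastCoord s g i.castSucc * mu i.castSucc
        = g i.castSucc * |mu i.castSucc| := fun i => by
      have hi : (i.castSucc : ℕ) + 1 < p + 2 := Nat.succ_lt_succ i.2
      rw [scaleLastCoord, if_neg hi.ne, abs_of_nonneg (hmu _ hi)]
    rw [Finset.sum_congr rfl fun i _ => h1 i, scaleLastCoord, if_pos (by simp)]
    ring
  rw [hrhs]
  have hterm : ∀ i, f i * mu i ≤ |f i| * |mu i| := fun i => by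
    rw [← abs_mul]; exact le_abs_self _
  rcases le_or_gt 0 (s * mu L) with hpos | hneg
  · have h1 : s * mu L = |mu L| := by
      rw [← abs_of_nonneg hpos, abs_mul]
      rcases hs1 with h | h <;> rw [h] <;> simp
    have h2 : g L * |mu L| - s * g L * mu L = 0 := by rw [← h1]; ring
    rw [h2, sub_zero]
    exact (Finset.sum_le_sum fun i _ => hterm i).trans hsort
  · have h1 : s * mu L = -|mu L| := by
      rw [← neg_eq_iff_eq_neg, ← abs_of_neg hneg, abs_mul]
      rcases hs1 with h | h <;> rw [h] <;> simp
    have h2 : g L * |mu L| - s * g L * mu L = 2 * (g L * |mu L|) := by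
      linear_combination (-g L) * h1
    have hmuL : 0 < |mu L| := by linarith
    obtain ⟨a, ha⟩ : ∃ a, signs f a * mu a ≤ 0 := by
      by_contra! hall
      have h3 : 0 < ∏ i, signs f i * mu i := Finset.prod_pos fun i _ => hall i
      rw [Finset.prod_mul_distrib, ← hs, Fin.prod_univ_castSucc] at h3
      have h4 : 0 ≤ ∏ i : Fin (p + 1), mu i.castSucc :=
        Finset.prod_nonneg fun i _ => hmu i.castSucc (Nat.succ_lt_succ i.2)
      have h5 := mul_nonpos_of_nonneg_of_nonpos h4 hneg.le
      rw [hL] at h5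
      linarith
    have h3 : f a * mu a = -(|f a| * |mu a|) := by
      have h4 : signs f a * mu a = -|mu a| := by
        rw [← neg_eq_iff_eq_neg, ← abs_of_nonpos ha, abs_mul]
        rcases signs_eq f a with h | h <;> rw [h] <;> simp
      rw [← signs_mul_abs f a, abs_mul, abs_abs]
      have h6 : |signs f a| = 1 := by rcases signs_eq f a with h | h <;> rw [h] <;> simp
      rw [h6]
      linear_combination |f a| * h4
    have h4 : ∑ i, f i * mu i ≤ ∑ i, |f i| * |mu i| - 2 * (|f a| * |mu a|) := by
      rw [← Finset.add_sum_erase _ _ (Finset.mem_univ a),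
        ← Finset.add_sum_erase _ (fun i => |f i| * |mu i|) (Finset.mem_univ a), h3]
      have := Finset.sum_le_sum fun i (_ : i ∈ Finset.univ.erase a) => hterm i
      linarith
    have h5 := hlast a
    rw [h2]
    exact h4.trans (by linarith)

/-- The analogue of `exists_chamber_pattern_A` in type `D`: the dominant `g` lists the absolute
values of the entries of `f`, the last one with the product of all signs. -/
theorem exists_chamber_pattern_D {r : ℕ} (hr : 2 ≤ r) {lam : Fin r → ℝ}
    (hlam : InChamber D r lam) (f : Fin r → ℝ) :
    ∃ g : Fin r → ℝ, InChamber D r g ∧ (InChamber D r (-g) → f = 0) ∧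
      (∀ mu : Fin r → ℝ, InChamber D r mu → f ⬝ᵥ mu ≤ g ⬝ᵥ mu) ∧
      ∃ T ∈ BZ D r lam, f ⬝ᵥ bzWeightMap r (r - 1) T = g ⬝ᵥ lam := by
  obtain ⟨p, rfl⟩ : ∃ p, r = p + 2 := ⟨r - 2, by omega⟩
  obtain ⟨σ, g, hg, hfg⟩ := exists_perm_antitone fun i => |f i|
  have hg0 : ∀ i, 0 ≤ g i := fun i => by
    obtain ⟨j, rfl⟩ := σ.surjective i
    rw [← hfg]
    exact abs_nonneg _
  set s : ℝ := ∏ i, signs f i with hs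
  have hs1 : s = 1 ∨ s = -1 := prod_signs_eq f
  have habs : ∀ i, |scaleLastCoord s g i| = g i := fun i => by
    unfold scaleLastCoord
    rcases hs1 with h | h <;> rw [h] <;> split_ifs <;> simp [abs_of_nonneg (hg0 i)]
  have hseq : ∀ b, b + 1 < p + 2 → toSeq (scaleLastCoord s g) b = toSeq g b := fun b hb => by
    rw [toSeq_of_lt _ (show b < p + 2 by omega), toSeq_of_lt _ (show b < p + 2 by omega),
      scaleLastCoord, if_neg hb.ne]
  have hlast : |toSeq (scaleLastCoord s g) (p + 1)| = toSeq g (p + 1) := by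
    rw [toSeq_of_lt _ (show p + 1 < p + 2 by omega), toSeq_of_lt _ (show p + 1 < p + 2 by omega),
      habs]
  have hlast' := abs_le.1 (hlast.trans_le (toSeq_succ_le hg p (by omega)))
  refine ⟨scaleLastCoord s g, (inChamber_D hr _).2 ⟨fun b hb => ?_, fun b hb => ?_⟩,
    fun hneg => ?_, fun mu hmu => ?_, ?_⟩
  · rw [hseq b hb]
    rcases Nat.lt_or_ge (b + 2) (p + 2) with h | h
    · rw [hseq (b + 1) h]
      exact toSeq_succ_le hg b hb
    · obtain rfl : b = p := by omega
      exact hlast'.2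
  · obtain rfl : b = p := by omega
    rw [hseq b (by omega)]
    linarith [hlast'.1]
  · obtain ⟨h1, h2⟩ := (inChamber_D hr _).1 hneg
    -- As `2 ≤ r`, the first entry of a vector in the chamber is nonnegative.
    have h3 := (nonneg_and_antitone_abs h1 h2).1 0 (by simp)
    have h5 : g 0 ≤ 0 := by
      rw [Pi.neg_apply, scaleLastCoord, if_neg (by simp)] at h3
      linarith
    funext i
    have h6 : |f i| ≤ 0 := (hfg i).trans_le ((hg (Fin.zero_le _)).trans h5)
    exact abs_nonpos_iff.1 h6
  · obtain ⟨h1, h2⟩ := (inChamber_D hr _).1 hmu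
    obtain ⟨h3, h4⟩ := nonneg_and_antitone_abs h1 h2
    exact dotProduct_le_scaleLastCoord hg hfg h3 h4
  · obtain ⟨h1, h2⟩ := (inChamber_D hr _).1 hlam
    obtain ⟨l, η, h3, h4, h5⟩ := exists_pattern_D h1 h2 σ (signs_eq f)
    refine ⟨(l, η), ⟨h3, h4⟩, ?_⟩
    rw [← dotProduct_scaleLastCoord, ← dotProduct_comp_perm g _ σ, ← funext hfg]
    refine Finset.sum_congr rfl fun i _ => (congrArg (f i * ·) (h5 i)).trans ?_
    beta_reduce
    rw [← mul_assoc, mul_signs]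

end ClassicalType

/-! ### The set of weights of patterns -/

namespace ClassicalType

open TriArray

/-- The vectors of coordinate sum `0`. -/
def sumZero (n : ℕ) : Submodule ℝ (Fin n → ℝ) :=
  LinearMap.ker (∑ i : Fin n, LinearMap.proj (R := ℝ) (φ := fun _ => ℝ) i)

theorem mem_sumZero {n : ℕ} {v : Fin n → ℝ} : v ∈ sumZero n ↔ ∑ i, v i = 0 := by
  rw [sumZero, LinearMap.mem_ker, LinearMap.sum_apply]
  rfl

/-- The span of the simple roots: the vectors of coordinate sum `0` in type `A`, and the whole space
in the other types. -/
def rootSpan : (X : ClassicalType) → (r : ℕ) → Submodule ℝ (Weight X r)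
  | A, r => sumZero (r + 1)
  | B, _ => ⊤
  | C, _ => ⊤
  | D, _ => ⊤

theorem finrank_rootSpan (X : ClassicalType) (r : ℕ) : finrank ℝ (rootSpan X r) = r := by
  have hfull : finrank ℝ (⊤ : Submodule ℝ (Fin r → ℝ)) = r := by
    rw [finrank_top, finrank_fin_fun]
  cases X
  · have hne : (∑ i : Fin (r + 1), LinearMap.proj (R := ℝ) (φ := fun _ => ℝ) i) ≠ 0 := fun h => by
      have := LinearMap.congr_fun h 1
      rw [LinearMap.sum_apply] at this
      simp at this
      exact absurd this (by positivity)
    have := Module.Dual.finrank_ker_add_one_of_ne_zero hne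
    rw [finrank_fin_fun] at this
    exact Nat.succ_injective this
  · exact hfull
  · exact hfull
  · exact hfull

theorem sum_eq_sum_A {r : ℕ} {lam mu : Fin (r + 1) → ℝ} {c : Fin r → ℝ}
    (h : lam - mu = ∑ i, c i • simpleRoot A r i) : ∑ i, lam i = ∑ i, mu i := by
  have hroot : ∀ i : Fin r, (1 : Fin (r + 1) → ℝ) ⬝ᵥ simpleRoot A r i = 0 := fun i => by
    refine (dotProduct_e_sub_e (1 : Fin (r + 1) → ℝ) (i : ℕ)).trans ?_
    rw [toSeq_of_lt _ (show (i : ℕ) < r + 1 by omega),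
      toSeq_of_lt _ (show (i : ℕ) + 1 < r + 1 by omega)]
    exact sub_self _
  rw [← sub_eq_zero, ← Finset.sum_sub_distrib]
  refine (one_dotProduct (lam - mu)).symm.trans ?_
  rw [h]
  refine (dotProduct_sum _ _ _).trans (Finset.sum_eq_zero fun i _ => ?_)
  exact (dotProduct_smul _ _ _).trans (by rw [hroot, smul_zero])

theorem sum_gtWeightMap {n m : ℕ} {lam : Fin n → ℝ} {T : TriArray n × TriArray m}
    (hT : ∀ k : Fin n, T.1.entry 1 ((k : ℕ) + 1) = lam k) :
    ∑ i, gtWeightMap n m T i = ∑ i, lam i := by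
  have h1 : ∑ i, gtWeightMap n m T i =
      ∑ k ∈ Finset.range n, (T.1.rowSum (k + 1) - T.1.rowSum (k + 1 + 1)) :=
    (Finset.sum_range fun k => T.1.rowSum (k + 1) - T.1.rowSum (k + 1 + 1)).symm
  have h2 : Finset.Icc 1 n = Finset.Ico 1 (n + 1) := by ext; simp
  rw [h1, Finset.sum_range_sub' (fun k => T.1.rowSum (k + 1)),
    rowSum_eq_zero T.1 (Nat.lt_succ_self n), sub_zero, zero_add, rowSum, h2,
    Finset.sum_Ico_eq_sum_range, Nat.add_sub_cancel, Finset.sum_range]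
  exact Finset.sum_congr rfl fun k _ => by rw [Nat.add_comm, hT]

/-- The weights of the patterns in `BZ X r lam` lie in `mu` plus the span of the roots. -/
theorem weightMap_sub_mem_rootSpan {X : ClassicalType} {r : ℕ} {lam mu : Weight X r}
    {c : Fin r → ℝ} (h : lam - mu = ∑ i, c i • simpleRoot X r i) {T : PatternSpace X r}
    (hT : T ∈ BZ X r lam) : weightMap X r T - mu ∈ rootSpan X r := by
  cases X
  · refine mem_sumZero.2 ((Finset.sum_sub_distrib _ _).trans (sub_eq_zero.2 ?_))
    exact (sum_gtWeightMap hT.2).trans (sum_eq_sum_A h)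
  all_goals exact Submodule.mem_top

/-- For every functional `f` there is a dominant `g` with `⟨f, mu⟩ ≤ ⟨g, mu⟩` for dominant `mu`, and
a pattern of highest weight `lam` whose weight has `f`-value `⟨g, lam⟩`. -/
theorem exists_chamber_pattern {X : ClassicalType} {r : ℕ} (hD : X = D → 2 ≤ r) {lam : Weight X r}
    (hlam : InChamber X r lam) (f : Weight X r) :
    ∃ g : Weight X r, InChamber X r g ∧
      (InChamber X r (-g) → ∀ u ∈ rootSpan X r, f ⬝ᵥ u = 0) ∧
      (∀ mu, InChamber X r mu → f ⬝ᵥ mu ≤ g ⬝ᵥ mu) ∧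
      ∃ T ∈ BZ X r lam, f ⬝ᵥ weightMap X r T = g ⬝ᵥ lam := by
  cases X
  · obtain ⟨g, h1, h2, h3⟩ := exists_chamber_pattern_A hlam f
    refine ⟨g, h1, fun hneg u hu => ?_, h3⟩
    have h4 : f ⬝ᵥ u = ∑ i, f (0 : Fin (r + 1)) * u i :=
      Finset.sum_congr rfl fun i _ => congrArg (· * u i) (h2 hneg i)
    rw [h4, ← Finset.mul_sum]
    exact (congrArg _ (mem_sumZero.1 hu)).trans (mul_zero _)
  · obtain ⟨g, h1, h2, h3⟩ := exists_chamber_pattern_BC hlam f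
    exact ⟨g, h1, fun hneg u _ => by rw [h2 hneg]; exact zero_dotProduct u, h3⟩
  · have hBC : ∀ v : Fin r → ℝ, InChamber C r v ↔ InChamber B r v := fun v =>
      (inChamber_C v).trans (inChamber_B v).symm
    obtain ⟨g, h1, h2, h3, h4⟩ := exists_chamber_pattern_BC ((hBC lam).1 hlam) f
    exact ⟨g, (hBC g).2 h1,
      fun hneg u _ => by rw [h2 ((hBC _).1 hneg)]; exact zero_dotProduct u,
      fun mu hmu => h3 mu ((hBC mu).1 hmu), h4⟩
  · obtain ⟨g, h1, h2, h3⟩ := exists_chamber_pattern_D (hD rfl) hlam f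
    exact ⟨g, h1, fun hneg u _ => by rw [h2 hneg]; exact zero_dotProduct u, h3⟩

/-- For a primitive pair, `mu` is not separated from the weights of patterns by any functional that
is nonzero on the span of the roots. -/
theorem exists_lt_weightMap {X : ClassicalType} {r : ℕ} (hD : X = D → 2 ≤ r)
    {lam mu : Weight X r} (hprim : IsPrimitivePair X r lam mu) (φ : Weight X r →ₗ[ℝ] ℝ)
    (hφ : ∃ u ∈ rootSpan X r, φ u ≠ 0) : ∃ T ∈ BZ X r lam, φ mu < φ (weightMap X r T) := by
  obtain ⟨hlam, hmu, c, hc, hsub⟩ := hprim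
  set f : Weight X r := fun i => φ fun j => if i = j then 1 else 0 with hf
  have hφf : ∀ v, φ v = f ⬝ᵥ v := fun v => by
    rw [LinearMap.pi_apply_eq_sum_univ φ v, dotProduct_comm]
    rfl
  obtain ⟨g, hg, hgneg, hgmu, T, hT, hval⟩ := exists_chamber_pattern hD hlam.inChamber f
  refine ⟨T, hT, ?_⟩
  obtain ⟨k, hk⟩ := exists_pos_of_not_inChamber_neg (v := g) fun hneg => by
    obtain ⟨u, hu, hne⟩ := hφ
    exact hne ((hφf u).trans (hgneg hneg u hu))
  have hpos : 0 < g ⬝ᵥ (lam - mu) := by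
    rw [hsub, dotProduct_sum]
    simp only [dotProduct_smul, smul_eq_mul]
    exact Finset.sum_pos' (fun i _ => mul_nonneg (Nat.cast_nonneg _) (hg i))
      ⟨k, Finset.mem_univ k, mul_pos (Nat.cast_pos.2 (hc k)) hk⟩
  rw [dotProduct_sub] at hpos
  rw [hφf, hφf, hval]
  linarith [hgmu mu hmu.inChamber]

end ClassicalType

theorem lemma3p9 (X : ClassicalType) (r : ℕ) (hD : X = ClassicalType.D → 2 ≤ r)
    (lam mu : ClassicalType.Weight X r) (hprim : ClassicalType.IsPrimitivePair X r lam mu) :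
    (ClassicalType.BZFiber X r lam mu).Nonempty ∧
      (affineDim (ClassicalType.BZFiber X r lam mu) : ℤ) =
        (affineDim (ClassicalType.BZ X r lam) : ℤ) - (r : ℤ) := by
  have _ : ∀ m, Fintype (TriIndex m) := fun m => Fintype.ofFinite _
  have hfiber : ClassicalType.BZFiber X r lam mu =
      {T | T ∈ ClassicalType.BZ X r lam ∧ ClassicalType.weightMap X r T = mu} := by
    ext T
    rw [Set.mem_ofPred_eq, ClassicalType.weightMap_apply]
    rfl
  have hne : (ClassicalType.BZ X r lam).Nonempty := by
    obtain ⟨g, -, -, -, T, hT, -⟩ :=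
      ClassicalType.exists_chamber_pattern hD hprim.1.inChamber 0
    exact ⟨T, hT⟩
  obtain ⟨c, hc, hsub⟩ := hprim.2.2
  obtain ⟨h1, h2⟩ := (ClassicalType.convex_BZ X r lam).affineDim_fiber hne
    (ClassicalType.weightMap X r) mu (ClassicalType.rootSpan X r)
    (fun T hT => ClassicalType.weightMap_sub_mem_rootSpan hsub hT)
    (ClassicalType.exists_lt_weightMap hD hprim)
  rw [ClassicalType.finrank_rootSpan] at h2
  rw [hfiber]
  exact ⟨h1, by omega⟩
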